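/- Let $(0,\infty]$ carry the metric $\rho(x,y)=|1/x-1/y|$, so that a closed subset is compact if and only if it is contained in $[t,\infty]$ for some $t>0$. For every $n\ge 1$ let $X_{n,1},\dots,X_{n,n}$ be independent non-negative random variables whose distributions $\mathcal P_{n,j}$ have no atoms, and let $c_{n,1},\dots,c_{n,n}$ be positive constants. Assume: ($H_1$) As $n\to\infty$, $d_n:=\sum_{j=1}^n c_{n,j}\to\infty$, $\ \max_{j\le n}c_{n,j}/d_n\to 0$, and the measures $\mu_n=\sum_{j=1}^n \frac{c_{n,j}}{d_n}\delta_{j/n}$ on $[0,1]$ converge weakly to a finite measure $\mu$. ($H_2$) There is a non-atomic measure $\gamma$ on $(0,\infty]$, finite on $[t,\infty]$ for every $t>0$, such that $\frac{d_n}{c_{n,j}}\mathcal P_{n,j}$ converges vaguely to $\gamma$ on $(0,\infty]$, uniformly in $j$: for every continuous $f:(0,\infty]\to[0,\infty)$ with compact support, $$\max_{j\le n}\left|\frac{d_n}{c_{n,j}}\int_{(0,\infty]} f\,d\mathcal P_{n,j}-\int_{(0,\infty]} f\,d\gamma\right|\longrightarrow 0\qquad(n\to\infty).$$ Then there exists a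 Poisson point process on $[0,1]\times(0,\infty]$ with intensity measure $\mu\times\gamma$, and for every such process $\zeta$ the point processes $\zeta_n=\sum_{j=1}^n\delta_{(j/n,\,X_{n,j})}$ on $[0,1]\times(0,\infty]$ (points with $X_{n,j}=0$, which occur with probability $0$, being discarded) converge weakly to $\zeta$; that is, the laws of $\zeta_n$ converge weakly to the law of $\zeta$ on the space of locally finite point measures on $[0,1]\times(0,\infty]$ with the vague topology. -/

import Mathlib

open MeasureTheory ProbabilityTheory Filter Topology
open scoped NNReal ENNReal unitInterval CompactlySupported

noncomputable section

/-- The half-line `(0, ∞]`, with the topology and Borel σ-algebra inherited from `[0, ∞]`. The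
topology is the one of the metric `|1/x - 1/y|`: a closed set is compact if and only if it is
contained in `[t, ∞]` for some `t > 0`. -/
abbrev PosHalfLine : Type := Set.Ioi (0 : ℝ≥0∞)

/-- Locally finite point measures on `E`: countable sums of Dirac masses (points may be repeated)
which are finite on compact sets. -/
structure PointMeasure (E : Type*) [TopologicalSpace E] [MeasurableSpace E] where
  /-- the underlying measure -/
  toMeasure : Measure E
  isSum : ∃ (ι : Type) (_ : Countable ι) (x : ι → E),
    toMeasure = Measure.sum fun i => Measure.dirac (x i)
  finite_of_isCompact : ∀ K : Set E, IsCompact K → toMeasure K < ∞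

/-- The vague topology: the coarsest one for which `κ ↦ ∫ f dκ` is continuous for every
non-negative continuous function `f` with compact support. -/
instance PointMeasure.instTopologicalSpace (E : Type*) [TopologicalSpace E] [MeasurableSpace E] :
    TopologicalSpace (PointMeasure E) :=
  TopologicalSpace.induced
    (fun (κ : PointMeasure E) (f : C_c(E, ℝ≥0)) => ∫⁻ x, (f x : ℝ≥0∞) ∂κ.toMeasure)
    Pi.topologicalSpace

/-- The Borel σ-algebra of the vague topology. -/
instance PointMeasure.instMeasurableSpace (E : Type*) [TopologicalSpace E] [MeasurableSpace E] :
    MeasurableSpace (PointMeasure E) :=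
  borel (PointMeasure E)

instance PointMeasure.instBorelSpace (E : Type*) [TopologicalSpace E] [MeasurableSpace E] :
    BorelSpace (PointMeasure E) :=
  ⟨rfl⟩

/-- `ζ` is a Poisson point process on `E` with intensity measure `ν`: a random point measure such
that the number of points in a measurable set `A` has the Poisson law of parameter `ν A` (and is
almost surely infinite if `ν A = ∞`), and such that the numbers of points in finitely many pairwise
disjoint measurable sets are independent. -/
structure IsPoissonPointProcess {E : Type*} [TopologicalSpace E] [MeasurableSpace E]
    {Ω : Type*} [MeasurableSpace Ω] (ζ : Ω → PointMeasure E) (ν : Measure E) (P : Measure Ω) :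
    Prop where
  measurable : Measurable ζ
  hasLaw_count : ∀ A : Set E, MeasurableSet A → ν A < ∞ →
    HasLaw (fun ω => (ζ ω).toMeasure A)
      ((poissonMeasure (ν A).toNNReal).map (fun k : ℕ => (k : ℝ≥0∞))) P
  count_eq_top : ∀ A : Set E, MeasurableSet A → ν A = ∞ → ∀ᵐ ω ∂P, (ζ ω).toMeasure A = ∞
  iIndepFun_count : ∀ (m : ℕ) (A : Fin m → Set E), (∀ i, MeasurableSet (A i)) →
    Pairwise (Function.onFun Disjoint A) →
    iIndepFun (fun (i : Fin m) ω => (ζ ω).toMeasure (A i)) P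

/-- The points `1/n, 2/n, …, n/n` of `[0, 1]`; the index `j : Fin n` stands for `j + 1`. -/
def gridPoint (n : ℕ) (j : Fin n) : I :=
  ⟨((j : ℝ) + 1) / n, by positivity,
    div_le_one_of_le₀ (by exact_mod_cast j.isLt) (Nat.cast_nonneg n)⟩

/-- The measure `∑ j, (c j / d) δ_{j/n}` on `[0, 1]`, where `d = ∑ j, c j`. -/
def weightMeasure (n : ℕ) (c : Fin n → ℝ) : FiniteMeasure I :=
  ∑ j, (c j / ∑ i, c i).toNNReal • (diracProba (gridPoint n j)).toFiniteMeasure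

/-- The restriction to `(0, ∞]` of the law of a non-negative random variable. -/
def posLaw {Ω : Type*} [MeasurableSpace Ω] (X : Ω → ℝ≥0) (P : Measure Ω) : Measure PosHalfLine :=
  (P.map fun ω => (X ω : ℝ≥0∞)).comap Subtype.val

/-- The point measure `∑ j, δ_{(j/n, x j)}` on `[0, 1] × (0, ∞]`. Terms with `x j = 0` lie outside
of this space and do not count. -/
def empiricalPointMeasure (n : ℕ) (x : Fin n → ℝ≥0) : PointMeasure (I × PosHalfLine) where
  toMeasure := Measure.sum fun j : {j : Fin n // 0 < x j} =>
    Measure.dirac (gridPoint n j, ⟨(x j : ℝ≥0∞), ENNReal.coe_pos.2 j.2⟩)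
  isSum := ⟨_, inferInstance, _, rfl⟩
  finite_of_isCompact K _ := by
    rw [Measure.sum_fintype]
    exact measure_lt_top _ K

end

/-! Both halves of the theorem rest on the characteristic functional `g ↦ E exp(i ∫ g dξ)`, which
for a Poisson process of intensity `ν` equals `exp(∫ (e^{ig} - 1) dν)`.

Convergence. By independence the functional of the empirical process is `∏ j, (1 + a n j)`, where `a
n j` is the integral of `e^{i g(j/n, x)} - 1` against the law of `X n j`. Vague convergence is
uniform in `j` and, by compactness of `[0, 1]`, over the sections `g (s, ·)`. Hence `a n j` is `c n
j / d n` times `∫ (e^{i g(j/n, x)} - 1) dγ + o(1)`, and weak convergence of the weight measures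
sends `∑ j, a n j` to `∫ (e^{ig} - 1) d(μ × γ)`. Since `max c / d → 0`, the product has the same
limit as `exp (∑ j, a n j)` (`tendsto_prod_one_add`).

From functionals to laws. The vague topology is induced by countably many pairings, so Lévy's
continuity theorem for finitely many of them gives the liminf inequality on open cylinders. Every
open set is an increasing union of such cylinders, and the limit law is given in advance, so no
tightness argument is needed (`tendstoInDistribution_of_tendsto_charFunctional`).

Existence. Write `ν` as a countable sum of multiples of probability measures, superpose independent
blocks consisting of a Poisson number of i.i.d. points, compute the functional, and recover the
count laws and their independence from it (`exists_isPoissonPointProcess`). -/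

/-! ### The vague topology: countable generation and measurability -/

/-- A compactly supported cutoff function equal to `1` on a given compact set. -/
theorem exists_cutoff {E : Type*} [TopologicalSpace E] [LocallyCompactSpace E] [T2Space E]
    {K : Set E} (hK : IsCompact K) :
    ∃ h : C_c(E, ℝ≥0), (∀ x ∈ K, h x = 1) ∧ ∀ x, h x ≤ 1 := by
  obtain ⟨f, h1, h2, -, h3⟩ :=
    exists_continuousMap_one_of_isCompact_subset_isOpen hK isOpen_univ (Set.subset_univ K)
  refine ⟨⟨⟨fun x => (f x).toNNReal, by fun_prop⟩, ?_⟩, fun x hx => ?_, fun x => ?_⟩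
  · exact HasCompactSupport.comp_left (g := Real.toNNReal) (f := f) h2 (by simp)
  · change (f x).toNNReal = 1
    simp [h1 hx]
  · change (f x).toNNReal ≤ 1
    simpa using (h3 x).2

/-- A countable family of compactly supported functions which approximates every other one
uniformly, relatively to a fixed member of the family. -/
theorem exists_countable_dense_family (E : Type*) [TopologicalSpace E] [LocallyCompactSpace E]
    [T2Space E] [SecondCountableTopology E] :
    ∃ F : ℕ → C_c(E, ℝ≥0), ∀ f : C_c(E, ℝ≥0), ∃ j, ∀ ε : ℝ≥0, 0 < ε →
      ∃ i, ∀ x, f x ≤ F i x + ε * F j x ∧ F i x ≤ f x + ε * F j x := by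
  classical
  obtain ⟨K⟩ : Nonempty (CompactExhaustion E) := inferInstance
  choose h h1 h2 using fun m => exists_cutoff (K.isCompact m)
  let g : ℕ → C(E, ℝ≥0) := TopologicalSpace.denseSeq C(E, ℝ≥0)
  -- `none` encodes the cutoffs themselves, `some i` the members of a dense sequence of `C(E, ℝ≥0)`
  -- truncated by a cutoff.
  let F : Option ℕ × ℕ → C_c(E, ℝ≥0) := fun p =>
    p.1.elim (h p.2) fun i =>
      ⟨⟨fun x => h p.2 x * g i x, by fun_prop⟩, (h p.2).hasCompactSupport.mul_right⟩
  obtain ⟨e, he⟩ := exists_surjective_nat (Option ℕ × ℕ)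
  refine ⟨F ∘ e, fun f => ?_⟩
  obtain ⟨m, hm⟩ := K.exists_superset_of_isCompact f.hasCompactSupport
  obtain ⟨j, hj⟩ := he (none, m)
  refine ⟨j, fun ε hε => ?_⟩
  have hd : ∀ᶠ u : C(E, ℝ≥0) in 𝓝 f.toContinuousMap,
      ∀ x ∈ tsupport (h m), dist (f.toContinuousMap x) (u x) < ε :=
    Metric.tendstoUniformlyOn_iff.1
      (ContinuousMap.tendsto_iff_forall_isCompact_tendstoUniformlyOn.1
        (tendsto_id (x := 𝓝 f.toContinuousMap)) _ (h m).hasCompactSupport) ε hε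
  obtain ⟨k, hk⟩ := (TopologicalSpace.denseRange_denseSeq C(E, ℝ≥0)).mem_nhds hd
  obtain ⟨i, hi⟩ := he (some k, m)
  refine ⟨i, fun x => ?_⟩
  have e1 : (F ∘ e) j x = h m x := by simp [F, hj]
  have e2 : (F ∘ e) i x = h m x * g k x := by
    simp only [Function.comp, F, hi]; rfl
  rw [e1, e2]
  -- The cutoff is `1` on the support of `f`, so multiplying `|f - g k| < ε` by `h m` leaves `f`
  -- unchanged and turns the error into `ε * h m`.
  have e3 : f x = h m x * f x := by
    by_cases hx : x ∈ tsupport f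
    · rw [h1 m x (hm hx), one_mul]
    · rw [image_eq_zero_of_notMem_tsupport hx, mul_zero]
  by_cases hx : x ∈ tsupport (h m)
  · have h4 : dist (f x) (g k x) < ε := hk x hx
    rw [NNReal.dist_eq, abs_lt] at h4
    have h5 : f x ≤ g k x + ε := by
      rw [← NNReal.coe_le_coe]; push_cast; linarith
    have h6 : g k x ≤ f x + ε := by
      rw [← NNReal.coe_le_coe]; push_cast; linarith
    constructor
    · calc f x = h m x * f x := e3
        _ ≤ h m x * (g k x + ε) := by gcongr
        _ = _ := by ring
    · calc h m x * g k x ≤ h m x * (f x + ε) := by gcongr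
        _ = h m x * f x + ε * h m x := by ring
        _ = _ := by rw [← e3]
  · have h0 := image_eq_zero_of_notMem_tsupport hx
    rw [h0, zero_mul] at e3
    rw [h0, e3]
    simp only [zero_mul, mul_zero, add_zero, le_refl, and_self]

section VagueTopology

variable {E : Type*} [TopologicalSpace E] [MeasurableSpace E]

instance PointMeasure.isFiniteMeasureOnCompacts (κ : PointMeasure E) :
    IsFiniteMeasureOnCompacts κ.toMeasure :=
  ⟨fun K hK => κ.finite_of_isCompact K hK⟩

theorem PointMeasure.continuous_lintegral (f : C_c(E, ℝ≥0)) :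
    Continuous fun κ : PointMeasure E => ∫⁻ x, (f x : ℝ≥0∞) ∂κ.toMeasure :=
  (continuous_apply f).comp (continuous_induced_dom
    (f := fun (κ : PointMeasure E) (f : C_c(E, ℝ≥0)) => ∫⁻ x, (f x : ℝ≥0∞) ∂κ.toMeasure))

namespace PointMeasure

/-- The integral of a compactly supported function, as a real number. -/
noncomputable def pairing (f : C_c(E, ℝ≥0)) (κ : PointMeasure E) : ℝ :=
  (∫⁻ x, (f x : ℝ≥0∞) ∂κ.toMeasure).toReal

variable [OpensMeasurableSpace E]

theorem integrable (f : C_c(E, ℝ≥0)) (κ : PointMeasure E) :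
    Integrable (fun x => (f x : ℝ)) κ.toMeasure :=
  Continuous.integrable_of_hasCompactSupport (by fun_prop)
    (f.hasCompactSupport.comp_left (g := ((↑) : ℝ≥0 → ℝ)) rfl)

theorem integrable_real (f : C_c(E, ℝ)) (κ : PointMeasure E) :
    Integrable (fun x => f x) κ.toMeasure :=
  f.continuous.integrable_of_hasCompactSupport f.hasCompactSupport

theorem pairing_eq_integral (f : C_c(E, ℝ≥0)) (κ : PointMeasure E) :
    pairing f κ = ∫ x, (f x : ℝ) ∂κ.toMeasure := by
  rw [pairing, integral_eq_lintegral_of_nonneg_ae (ae_of_all _ fun x => by positivity)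
    (κ.integrable f).aestronglyMeasurable]
  simp

theorem lintegral_ne_top (f : C_c(E, ℝ≥0)) (κ : PointMeasure E) :
    ∫⁻ x, (f x : ℝ≥0∞) ∂κ.toMeasure ≠ ∞ := by
  have := (κ.integrable f).lintegral_lt_top
  simpa using this.ne

theorem continuous_pairing (f : C_c(E, ℝ≥0)) :
    Continuous fun κ : PointMeasure E => pairing f κ :=
  ENNReal.continuousOn_toReal.comp_continuous (continuous_lintegral f) fun κ =>
    κ.lintegral_ne_top f

/-- The vague topology is induced by countably many of the pairings. -/
theorem exists_isInducing_pairing (E : Type*) [TopologicalSpace E] [LocallyCompactSpace E]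
    [T2Space E] [SecondCountableTopology E] [MeasurableSpace E] [OpensMeasurableSpace E] :
    ∃ F : ℕ → C_c(E, ℝ≥0),
      IsInducing fun (κ : PointMeasure E) (i : ℕ) => pairing (F i) κ := by
  obtain ⟨F, hF⟩ := exists_countable_dense_family E
  refine ⟨F, isInducing_iff_nhds.2 fun κ => le_antisymm ?_ ?_⟩
  · rw [← tendsto_iff_comap]
    exact (continuous_pi fun i => continuous_pairing (F i)).tendsto κ
  · rw [nhds_induced, ← tendsto_iff_comap, tendsto_pi_nhds]
    intro f
    set l := comap (fun (κ : PointMeasure E) (i : ℕ) => pairing (F i) κ)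
      (𝓝 fun i => pairing (F i) κ)
    have hl : ∀ i, Tendsto (pairing (F i)) l (𝓝 (pairing (F i) κ)) :=
      fun i => ((continuous_apply i).tendsto _).comp (tendsto_comap
      (f := fun (κ : PointMeasure E) (i : ℕ) => pairing (F i) κ))
    suffices h : Tendsto (pairing f) l (𝓝 (pairing f κ)) by
      have := ENNReal.tendsto_ofReal h
      simpa only [pairing, ENNReal.ofReal_toReal (lintegral_ne_top f _)] using this
    obtain ⟨j, hj⟩ := hF f
    have hpos : ∀ κ' : PointMeasure E, 0 ≤ pairing (F j) κ' := fun κ' => ENNReal.toReal_nonneg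
    rw [Metric.tendsto_nhds]
    intro δ hδ
    -- Three errors must add up to `δ`: `δ / C` times `pairing (F j) κ`, times `pairing (F j) κ' ≤
    -- pairing (F j) κ + 1`, and times `1`.
    set C := 2 * pairing (F j) κ + 2
    have hC : 0 < C := by have := hpos κ; positivity
    obtain ⟨i, hi⟩ := hj (δ / C).toNNReal (by simpa using by positivity)
    have key : ∀ κ' : PointMeasure E,
        pairing f κ' ≤ pairing (F i) κ' + δ / C * pairing (F j) κ' ∧
        pairing (F i) κ' ≤ pairing f κ' + δ / C * pairing (F j) κ' := by
      intro κ'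
      have hx : ∀ x, (f x : ℝ) ≤ F i x + δ / C * F j x ∧ (F i x : ℝ) ≤ f x + δ / C * F j x := by
        intro x
        have := hi x
        rw [← NNReal.coe_le_coe, ← NNReal.coe_le_coe] at this
        push_cast at this
        rwa [Real.coe_toNNReal _ (by positivity)] at this
      simp only [pairing_eq_integral]
      rw [← integral_const_mul, ← integral_add (κ'.integrable _) ((κ'.integrable _).const_mul _),
        ← integral_add (κ'.integrable _) ((κ'.integrable _).const_mul _)]
      constructor
      · exact integral_mono (κ'.integrable _)
          ((κ'.integrable _).add ((κ'.integrable _).const_mul _)) fun x => (hx x).1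
      · exact integral_mono (κ'.integrable _)
          ((κ'.integrable _).add ((κ'.integrable _).const_mul _)) fun x => (hx x).2
    have hs : 0 < δ / C := by positivity
    filter_upwards [Metric.tendsto_nhds.1 (hl i) (δ / C) hs,
      Metric.tendsto_nhds.1 (hl j) 1 one_pos] with κ' h1 h2
    rw [Real.dist_eq, abs_lt] at *
    have k1 := key κ
    have k2 := key κ'
    have h3 : δ / C * pairing (F j) κ' ≤ δ / C * (pairing (F j) κ + 1) := by
      gcongr; linarith
    have h4 : δ = δ / C * C := by field_simp
    have h5 : δ / C * C = δ / C * (pairing (F j) κ) + δ / C * (pairing (F j) κ + 1) + δ / C := by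
      simp only [C]; ring
    constructor <;> linarith

section Measurability

variable [LocallyCompactSpace E] [T2Space E] [SecondCountableTopology E]

/-- Open sets pull back from open sets of the countable product of real lines, whose Borel and
product σ-algebras agree; so only countably many pairings need be measurable. -/
theorem measurable_of_toMeasure {Ω : Type*} [MeasurableSpace Ω] {ξ : Ω → PointMeasure E}
    (hξ : Measurable fun ω => (ξ ω).toMeasure) : Measurable ξ := by
  obtain ⟨F, hF⟩ := exists_isInducing_pairing E
  have h : Measurable fun ω (i : ℕ) => pairing (F i) (ξ ω) := by
    refine measurable_pi_lambda _ fun i => Measurable.ennreal_toReal ?_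
    exact (Measure.measurable_lintegral (f := fun x => (F i x : ℝ≥0∞))
      (by fun_prop)).comp hξ
  refine measurable_of_isOpen fun U hU => ?_
  obtain ⟨V, hV, rfl⟩ := hF.isOpen_iff.1 hU
  exact h hV.measurableSet

end Measurability

/-- Weighting by a cutoff gives a finite measure, for which closed sets are limits of continuous
functions and form a generating π-system. On `K m` the weight is `1`, so the original measure is
recovered along the exhaustion. -/
theorem measurable_toMeasure [BorelSpace E] [LocallyCompactSpace E] [T2Space E]
    [SecondCountableTopology E] : Measurable (toMeasure : PointMeasure E → Measure E) := by
  obtain ⟨K⟩ : Nonempty (CompactExhaustion E) := inferInstance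
  choose h h1 h2 using fun m => exists_cutoff (K.isCompact m)
  let κm : ℕ → PointMeasure E → Measure E := fun m κ =>
    κ.toMeasure.withDensity fun x => (h m x : ℝ≥0∞)
  have hfin : ∀ m κ, IsFiniteMeasure (κm m κ) := fun m κ =>
    isFiniteMeasure_withDensity (κ.lintegral_ne_top (h m))
  have hlin : ∀ (m : ℕ) (f : C(E, ℝ≥0)), Measurable fun κ => ∫⁻ x, (f x : ℝ≥0∞) ∂(κm m κ) := by
    intro m f
    let g : C_c(E, ℝ≥0) := ⟨⟨fun x => h m x * f x, by fun_prop⟩,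
      (h m).hasCompactSupport.mul_right⟩
    convert! (continuous_lintegral g).measurable using 2 with κ
    simp only [κm]
    rw [lintegral_withDensity_eq_lintegral_mul _ (by fun_prop) (by fun_prop)]
    rfl
  have hmeas : ∀ m, Measurable (κm m) := by
    intro m
    refine Measurable.measure_of_isPiSystem
      (BorelSpace.measurable_eq.trans borel_eq_generateFrom_isClosed) isPiSystem_isClosed
      (fun s hs => ?_) ?_
    · exact measurable_of_tendsto_metrizable (fun n => hlin m (hs.apprSeq n).toContinuousMap)
        (tendsto_pi_nhds.2 fun κ => HasOuterApproxClosed.tendsto_lintegral_apprSeq hs (κm m κ))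
    · simpa using hlin m 1
  refine Measure.measurable_of_measurable_coe _ fun A hA => ?_
  have hK : ∀ m (κ : PointMeasure E), κm m κ (A ∩ K m) = κ.toMeasure (A ∩ K m) := by
    intro m κ
    have hAK := hA.inter (K.isCompact m).measurableSet
    rw [withDensity_apply _ hAK, setLIntegral_congr_fun hAK (g := fun _ => 1)
      (fun x hx => by simp [h1 m x hx.2])]
    simp
  have hsup : ∀ κ : PointMeasure E, κ.toMeasure A = ⨆ m, κm m κ (A ∩ K m) := by
    intro κ
    simp only [hK]
    rw [← Monotone.measure_iUnion, ← Set.inter_iUnion, K.iUnion_eq, Set.inter_univ]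
    exact fun a b hab => Set.inter_subset_inter_right _ (K.subset hab)
  simp only [hsup]
  exact Measurable.iSup fun m =>
    Measure.measurable_coe (hA.inter (K.isCompact m).measurableSet) |>.comp (hmeas m)

theorem measurable_integral [BorelSpace E] [LocallyCompactSpace E] [T2Space E]
    [SecondCountableTopology E] (f : C_c(E, ℝ)) :
    Measurable fun κ : PointMeasure E => ∫ x, f x ∂κ.toMeasure := by
  have h : ∀ κ : PointMeasure E, ∫ x, f x ∂κ.toMeasure =
      pairing f.nnrealPart κ - pairing (-f).nnrealPart κ := by
    intro κ
    rw [pairing_eq_integral, pairing_eq_integral, ← integral_sub (κ.integrable _) (κ.integrable _)]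
    congr with x
    exact (DFunLike.congr_fun f.nnrealPart_sub_nnrealPart_neg x).symm.trans (by simp)
  simp only [h]
  exact (continuous_pairing _).measurable.sub (continuous_pairing _).measurable

end PointMeasure

end VagueTopology

/-! ### Weak convergence from characteristic functionals -/

/-- Weak convergence can be tested on the open cylinders given by finitely many coordinates of an
inducing map into a countable product. -/
theorem tendsto_of_isInducing_of_le_liminf {S : Type*} [TopologicalSpace S] [MeasurableSpace S]
    [OpensMeasurableSpace S] {φ : S → ℕ → ℝ} (hφ : IsInducing φ) {μ : ProbabilityMeasure S}
    {μs : ℕ → ProbabilityMeasure S}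
    (h : ∀ (m : ℕ) (V : Set (Fin m → ℝ)), IsOpen V →
      (μ : Measure S) ((fun s (i : Fin m) => φ s i) ⁻¹' V) ≤
        liminf (fun n => (μs n : Measure S) ((fun s (i : Fin m) => φ s i) ⁻¹' V)) atTop) :
    Tendsto μs atTop (𝓝 μ) := by
  refine tendsto_of_forall_isOpen_le_liminf' fun G hG => ?_
  obtain ⟨W, hW, rfl⟩ := hφ.isOpen_iff.1 hG
  let res : ∀ m : ℕ, (ℕ → ℝ) → Fin m → ℝ := fun m w i => w i
  -- The largest open set in the first `m` coordinates whose cylinder lies in `W`; maximality makes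
  -- these cylinders increase with `m`.
  let V : ∀ m : ℕ, Set (Fin m → ℝ) := fun m => ⋃₀ {O | IsOpen O ∧ res m ⁻¹' O ⊆ W}
  have hV : ∀ m, IsOpen (V m) := fun m => isOpen_sUnion fun O hO => hO.1
  have hVW : ∀ m, res m ⁻¹' V m ⊆ W := by
    rintro m w ⟨O, hO, hw⟩
    exact hO.2 hw
  have hmono : Monotone fun m => res m ⁻¹' V m := by
    rintro a b hab w ⟨O, hO, hw⟩
    refine ⟨(fun v i => v (Fin.castLE hab i)) ⁻¹' O, ⟨hO.1.preimage (by fun_prop), ?_⟩, hw⟩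
    exact fun w' hw' => hO.2 hw'
  have hcover : W = ⋃ m, res m ⁻¹' V m := by
    refine subset_antisymm (fun w hw => ?_) (Set.iUnion_subset hVW)
    obtain ⟨J, u, hu, hJ⟩ := isOpen_pi_iff.1 hW w hw
    obtain ⟨m, hm⟩ := J.exists_nat_subset_range
    refine Set.mem_iUnion.2 ⟨m, {v | ∀ i : Fin m, (i : ℕ) ∈ J → v i ∈ u i}, ⟨?_, ?_⟩, ?_⟩
    · simp only [Set.ofPred_forall]
      exact isOpen_iInter_of_finite fun i => isOpen_iInter_of_finite fun hi =>
        (hu i hi).1.preimage (continuous_apply i)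
    · intro w' hw'
      exact hJ fun i hi => hw' ⟨i, Finset.mem_range.1 (hm hi)⟩ hi
    · exact fun i hi => (hu i hi).2
  have hsup : (μ : Measure S) (φ ⁻¹' W) = ⨆ m, (μ : Measure S) (φ ⁻¹' (res m ⁻¹' V m)) := by
    conv_lhs => rw [hcover, Set.preimage_iUnion]
    exact Monotone.measure_iUnion fun a b hab => Set.preimage_mono (hmono hab)
  rw [hsup]
  refine iSup_le fun m => (h m (V m) (hV m)).trans ?_
  exact liminf_le_liminf (.of_forall fun n => measure_mono (Set.preimage_mono (hVW m)))

section CharacteristicFunctional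

variable {E : Type*} [TopologicalSpace E] [LocallyCompactSpace E] [T2Space E]
  [SecondCountableTopology E] [MeasurableSpace E] [BorelSpace E]

/-- Random point measures converge in distribution as soon as their characteristic functionals
converge. -/
theorem tendstoInDistribution_of_tendsto_charFunctional {Ω : ℕ → Type*}
    [∀ n, MeasurableSpace (Ω n)] {P : ∀ n, Measure (Ω n)} [∀ n, IsProbabilityMeasure (P n)]
    {Ω' : Type*} [MeasurableSpace Ω'] {P' : Measure Ω'} [IsProbabilityMeasure P']
    {ξ : ∀ n, Ω n → PointMeasure E} {ζ : Ω' → PointMeasure E} (hξ : ∀ n, Measurable (ξ n))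
    (hζ : Measurable ζ)
    (h : ∀ g : C_c(E, ℝ), Tendsto
      (fun n => ∫ ω, Complex.exp ((∫ x, g x ∂(ξ n ω).toMeasure : ℝ) * Complex.I) ∂(P n)) atTop
      (𝓝 (∫ ω, Complex.exp ((∫ x, g x ∂(ζ ω).toMeasure : ℝ) * Complex.I) ∂P'))) :
    TendstoInDistribution ξ atTop ζ P P' := by
  obtain ⟨F, hF⟩ := PointMeasure.exists_isInducing_pairing E
  refine ⟨fun n => (hξ n).aemeasurable, hζ.aemeasurable,
    tendsto_of_isInducing_of_le_liminf hF fun m V hV => ?_⟩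
  let φ : PointMeasure E → EuclideanSpace ℝ (Fin m) := fun κ =>
    WithLp.toLp 2 fun i => PointMeasure.pairing (F i) κ
  have hφ : Continuous φ := (PiLp.continuous_toLp 2 _).comp
    (continuous_pi fun i => PointMeasure.continuous_pairing (F i))
  have hV' : IsOpen (WithLp.ofLp ⁻¹' V : Set (EuclideanSpace ℝ (Fin m))) :=
    hV.preimage (PiLp.continuous_ofLp 2 _)
  -- A linear combination of pairings is the integral of one compactly supported function, so the
  -- finite-dimensional characteristic functions are values of the functional.
  have hchar : ∀ (Q : Measure (PointMeasure E)) (t : EuclideanSpace ℝ (Fin m)),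
      charFun (Q.map φ) t =
        ∫ κ, Complex.exp ((∫ x, (∑ i, t i • (F i).toReal) x ∂κ.toMeasure : ℝ) * Complex.I) ∂Q := by
    intro Q t
    rw [charFun_apply, integral_map hφ.measurable.aemeasurable (by fun_prop)]
    congr with κ
    congr 3
    simp only [φ, PiLp.inner_apply, PointMeasure.pairing_eq_integral,
      CompactlySupportedContinuousMap.coe_sum, CompactlySupportedContinuousMap.coe_smul,
      Finset.sum_apply, Pi.smul_apply, smul_eq_mul, CompactlySupportedContinuousMap.toReal_apply]
    rw [integral_finsetSum (f := fun (i : Fin m) x => t i * (F i x : ℝ)) _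
      fun i _ => (κ.integrable (F i)).const_mul _]
    simp [integral_const_mul]
  have hmeas : ∀ g : C_c(E, ℝ), Measurable fun κ : PointMeasure E =>
      Complex.exp ((∫ x, g x ∂κ.toMeasure : ℝ) * Complex.I) := by
    intro g
    have := PointMeasure.measurable_integral g
    fun_prop
  let Q' : ProbabilityMeasure (PointMeasure E) :=
    ⟨P'.map ζ, Measure.isProbabilityMeasure_map hζ.aemeasurable⟩
  let Q : ℕ → ProbabilityMeasure (PointMeasure E) := fun n =>
    ⟨(P n).map (ξ n), Measure.isProbabilityMeasure_map (hξ n).aemeasurable⟩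
  have hQ' : (Q' : Measure (PointMeasure E)) = P'.map ζ := rfl
  have hQ : ∀ n, (Q n : Measure (PointMeasure E)) = (P n).map (ξ n) := fun n => rfl
  have key : Tendsto (fun n => (Q n).map hφ.measurable.aemeasurable) atTop
      (𝓝 (Q'.map hφ.measurable.aemeasurable)) := by
    refine ProbabilityMeasure.tendsto_iff_tendsto_charFun.2 fun t => ?_
    simp only [ProbabilityMeasure.toMeasure_map, hchar, hQ, hQ',
      integral_map (hξ _).aemeasurable (hmeas _).aestronglyMeasurable,
      integral_map hζ.aemeasurable (hmeas _).aestronglyMeasurable]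
    exact h _
  have := ProbabilityMeasure.le_liminf_measure_open_of_tendsto key hV'
  simp only [ProbabilityMeasure.toMeasure_map,
    Measure.map_apply hφ.measurable hV'.measurableSet] at this
  exact this

end CharacteristicFunctional

/-! ### The characteristic functional of a Poisson process -/

theorem norm_cexp_mul_I_sub_one_le (x : ℝ) : ‖Complex.exp (x * Complex.I) - 1‖ ≤ |x| := by
  simpa [mul_comm] using Real.norm_exp_I_mul_ofReal_sub_one_le (x := x)

theorem integrable_cexp_mul_I_sub_one {α : Type*} [MeasurableSpace α] {ν : Measure α} {f : α → ℝ}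
    (hf : Integrable f ν) : Integrable (fun x => Complex.exp (f x * Complex.I) - 1) ν := by
  refine hf.mono ?_ (ae_of_all _ fun x => ?_)
  · have := hf.aestronglyMeasurable.aemeasurable
    exact AEMeasurable.aestronglyMeasurable (by fun_prop)
  · exact norm_cexp_mul_I_sub_one_le _

/-- The value `0` is left out because its fibre may have infinite measure; the other fibres have
finite measure by integrability. -/
theorem MeasureTheory.SimpleFunc.integral_eq_sum_filter_range {α : Type*} [MeasurableSpace α]
    {F : Type*} [NormedAddCommGroup F] [NormedSpace ℝ F] (φ : SimpleFunc α ℝ) {ν : Measure α}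
    (hφ : Integrable φ ν) (g : ℝ → F) (hg : g 0 = 0) [CompleteSpace F] :
    ∫ x, g (φ x) ∂ν = ∑ y ∈ φ.range with y ≠ 0, ν.real (φ ⁻¹' {y}) • g y := by
  have h := SimpleFunc.map_integral φ g hφ hg
  have hint : Integrable (φ.map g) ν := by
    rw [SimpleFunc.integrable_iff_finMeasSupp] at hφ ⊢
    exact hφ.map hg
  rw [SimpleFunc.integral_eq_integral _ hint] at h
  simp only [SimpleFunc.map_apply] at h
  rw [h]
  symm
  refine Finset.sum_subset (Finset.filter_subset _ _) fun y hy hy' => ?_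
  have : y = 0 := by simpa [hy] using hy'
  simp [this, hg]

namespace IsPoissonPointProcess

variable {E : Type*} [TopologicalSpace E] [MeasurableSpace E]
  {Ω : Type*} [MeasurableSpace Ω] {P : Measure Ω}
  {ζ : Ω → PointMeasure E} {ν : Measure E}

theorem integral_cexp_count (hζ : IsPoissonPointProcess ζ ν P) {A : Set E} (hA : MeasurableSet A)
    (hνA : ν A < ∞) (y : ℝ) :
    ∫ ω, Complex.exp ((((ζ ω).toMeasure A).toReal * y : ℝ) * Complex.I) ∂P =
      Complex.exp (ν.real A • (Complex.exp (y * Complex.I) - 1)) := by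
  have h := hζ.hasLaw_count A hA hνA
  let f : ℝ≥0∞ → ℂ := fun u => Complex.exp ((u.toReal * y : ℝ) * Complex.I)
  have hf : Measurable f := by fun_prop
  have h1 : ∫ ω, f ((ζ ω).toMeasure A) ∂P = ∫ u, f u ∂(P.map fun ω => (ζ ω).toMeasure A) :=
    (integral_map h.aemeasurable hf.aestronglyMeasurable).symm
  change ∫ ω, f ((ζ ω).toMeasure A) ∂P = _
  rw [h1, h.map_eq, integral_map (by fun_prop) hf.aestronglyMeasurable]
  have h2 := charFun_map_cast_poissonMeasure (ν A).toNNReal y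
  rw [charFun_apply, integral_map (by fun_prop) (by fun_prop)] at h2
  simp only [f, ENNReal.toReal_natCast, Measure.real, Complex.real_smul]
  rw [show (ν A).toReal = ((ν A).toNNReal : ℝ) from rfl]
  simpa [mul_comm] using h2

variable [LocallyCompactSpace E] [T2Space E] [SecondCountableTopology E]
  [BorelSpace E]

theorem integral_cexp_simpleFunc (hζ : IsPoissonPointProcess ζ ν P) (φ : SimpleFunc E ℝ)
    (hφ : Integrable φ ν) (hφζ : ∀ ω, Integrable φ (ζ ω).toMeasure) :
    ∫ ω, Complex.exp ((∫ x, φ x ∂(ζ ω).toMeasure : ℝ) * Complex.I) ∂P =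
      Complex.exp (∫ x, (Complex.exp (φ x * Complex.I) - 1) ∂ν) := by
  set S : Finset ℝ := {y ∈ φ.range | y ≠ 0} with hS
  let e : Fin S.card ≃ S := S.equivFin.symm
  have hA : ∀ y, MeasurableSet (φ ⁻¹' {y}) := fun y => φ.measurableSet_fiber y
  have hind := hζ.iIndepFun_count S.card (fun i => φ ⁻¹' {(e i : ℝ)}) (fun i => hA _) (by
    intro i j hij
    refine Disjoint.preimage _ (Set.disjoint_singleton.2 fun h => hij ?_)
    exact e.injective (Subtype.ext h))
  have hmeas : ∀ y, Measurable fun ω => (ζ ω).toMeasure (φ ⁻¹' {y}) := fun y =>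
    (Measure.measurable_coe (hA y)).comp (PointMeasure.measurable_toMeasure.comp hζ.measurable)
  have h1 : ∀ ω, ∫ x, φ x ∂(ζ ω).toMeasure =
      ∑ y ∈ S, ((ζ ω).toMeasure (φ ⁻¹' {y})).toReal * y := fun ω =>
    φ.integral_eq_sum_filter_range (hφζ ω) id rfl
  have h2 := φ.integral_eq_sum_filter_range hφ
    (fun y : ℝ => Complex.exp (y * Complex.I) - 1) (by simp)
  rw [h2, ← hS, Complex.exp_sum]
  -- Independence of counts is available for families indexed by `Fin m`, hence the passage from `S`
  -- to `Fin S.card`.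
  have hsum : ∀ {M : Type} [CommMonoid M] (u : ℝ → M), ∏ y ∈ S, u y = ∏ i, u (e i) := by
    intro M _ u
    rw [← Finset.prod_coe_sort S u]
    exact (e.prod_comp fun y : S => u y).symm
  rw [hsum]
  have h3 : ∀ i, Complex.exp (ν.real (φ ⁻¹' {(e i : ℝ)}) •
      (Complex.exp ((e i : ℝ) * Complex.I) - 1)) =
      ∫ ω, Complex.exp ((((ζ ω).toMeasure (φ ⁻¹' {(e i : ℝ)})).toReal * (e i) : ℝ) * Complex.I)
        ∂P := by
    intro i
    refine (hζ.integral_cexp_count (hA _) ?_ _).symm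
    exact SimpleFunc.measure_preimage_lt_top_of_integrable φ hφ (Finset.mem_filter.1 (e i).2).2
  simp only [h3]
  rw [← iIndepFun.integral_fun_prod_comp (𝕜 := ℂ)
    (f := fun i u => Complex.exp ((u.toReal * (e i) : ℝ) * Complex.I)) hind
    (fun i => (hmeas _).aemeasurable)
    (fun i => Measurable.aestronglyMeasurable (by fun_prop))]
  congr with ω
  rw [h1, ← hsum fun y : ℝ =>
    Complex.exp ((((ζ ω).toMeasure (φ ⁻¹' {y})).toReal * y : ℝ) * Complex.I), ← Complex.exp_sum,
    ← Finset.sum_mul]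
  push_cast
  rfl

/-- The characteristic functional of a Poisson point process. -/
theorem integral_cexp [IsProbabilityMeasure P] (hζ : IsPoissonPointProcess ζ ν P)
    [IsFiniteMeasureOnCompacts ν]
    (g : C_c(E, ℝ)) :
    ∫ ω, Complex.exp ((∫ x, g x ∂(ζ ω).toMeasure : ℝ) * Complex.I) ∂P =
      Complex.exp (∫ x, (Complex.exp (g x * Complex.I) - 1) ∂ν) := by
  have hgm : Measurable g := g.continuous.measurable
  have hν : Integrable g ν := g.continuous.integrable_of_hasCompactSupport g.hasCompactSupport
  let φ : ℕ → SimpleFunc E ℝ := SimpleFunc.approxOn g hgm Set.univ 0 (Set.mem_univ _)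
  -- This single bound dominates the approximations both under `ν` and under every realization of
  -- `ζ`.
  have hb : ∀ n x, ‖φ n x‖ ≤ ‖2 * g x‖ := fun n x => by
    have := SimpleFunc.norm_approxOn_zero_le hgm (Set.mem_univ _) x n
    rw [norm_mul, Real.norm_ofNat, two_mul]
    exact this
  have hlim : ∀ x, Tendsto (fun n => φ n x) atTop (𝓝 (g x)) := fun x =>
    SimpleFunc.tendsto_approxOn hgm (Set.mem_univ _) (by simp)
  have hint : ∀ (κ : Measure E), Integrable g κ → ∀ n, Integrable (φ n) κ := fun κ hκ n =>
    (hκ.const_mul 2).mono (φ n).aestronglyMeasurable (ae_of_all _ fun x => hb n x)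
  have h1 : ∀ ω, Tendsto (fun n => ∫ x, φ n x ∂(ζ ω).toMeasure) atTop
      (𝓝 (∫ x, g x ∂(ζ ω).toMeasure)) := fun ω =>
    tendsto_integral_of_dominated_convergence _ (fun n => (φ n).aestronglyMeasurable)
      (((ζ ω).integrable_real g).const_mul 2).norm (fun n => ae_of_all _ (hb n))
      (ae_of_all _ hlim)
  have h2 : Tendsto (fun n => ∫ x, (Complex.exp (φ n x * Complex.I) - 1) ∂ν) atTop
      (𝓝 (∫ x, (Complex.exp (g x * Complex.I) - 1) ∂ν)) := by
    refine tendsto_integral_of_dominated_convergence _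
      (fun n => (integrable_cexp_mul_I_sub_one (hint ν hν n)).aestronglyMeasurable)
      (hν.const_mul 2).norm
      (fun n => ae_of_all _ fun x => (norm_cexp_mul_I_sub_one_le _).trans (hb n x))
      (ae_of_all _ fun x => ?_)
    exact Tendsto.sub_const ((Complex.continuous_exp.tendsto _).comp
      (((Complex.continuous_ofReal.tendsto _).comp (hlim x)).mul_const _)) _
  have hm : ∀ n, Measurable fun ω => ∫ x, φ n x ∂(ζ ω).toMeasure := by
    intro n
    have : ∀ ω, ∫ x, φ n x ∂(ζ ω).toMeasure = _ := fun ω =>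
      (φ n).integral_eq_sum_filter_range (hint _ ((ζ ω).integrable_real g) n) id rfl
    simp only [this]
    refine Finset.measurable_sum _ fun y _ => Measurable.smul_const ?_ _
    exact ((Measure.measurable_coe ((φ n).measurableSet_fiber y)).comp
      (PointMeasure.measurable_toMeasure.comp hζ.measurable)).ennreal_toReal
  have h3 : Tendsto (fun n => ∫ ω, Complex.exp ((∫ x, φ n x ∂(ζ ω).toMeasure : ℝ) * Complex.I) ∂P)
      atTop (𝓝 (∫ ω, Complex.exp ((∫ x, g x ∂(ζ ω).toMeasure : ℝ) * Complex.I) ∂P)) := by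
    refine tendsto_integral_of_dominated_convergence (fun _ => 1)
      (fun n => Measurable.aestronglyMeasurable ?_) (integrable_const _)
      (fun n => ae_of_all _ fun ω => (Complex.norm_exp_ofReal_mul_I _).le)
      (ae_of_all _ fun ω => ?_)
    · have := hm n
      fun_prop
    · exact (Complex.continuous_exp.tendsto _).comp
        (((Complex.continuous_ofReal.tendsto _).comp (h1 ω)).mul_const _)
  refine tendsto_nhds_unique h3 ?_
  simp only [fun n => hζ.integral_cexp_simpleFunc (φ n) (hint ν hν n)
    fun ω => hint _ ((ζ ω).integrable_real g) n]
  exact (Complex.continuous_exp.tendsto _).comp h2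

end IsPoissonPointProcess

/-! ### Construction: independent blocks of Poisson many points -/

theorem lintegral_natCast_poissonMeasure (r : ℝ≥0) :
    ∫⁻ n, (n : ℝ≥0∞) ∂(poissonMeasure r) = r := by
  have h : HasSum (fun n : ℕ => Real.exp (-r) * r ^ n / n.factorial * n) (r : ℝ) := by
    rw [← hasSum_nat_add_iff' 1]
    simp only [Finset.range_one, Finset.sum_singleton, Nat.cast_zero, mul_zero, sub_zero]
    convert! (hasSum_one_poissonMeasure r).mul_left (r : ℝ) using 1
    · ext n
      rw [Nat.factorial_succ]
      push_cast
      field_simp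
      ring
    · simp
  rw [lintegral_countable']
  have h2 : ∀ n : ℕ, (n : ℝ≥0∞) * poissonMeasure r {n} =
      ENNReal.ofReal (Real.exp (-r) * r ^ n / n.factorial * n) := by
    intro n
    rw [poissonMeasure_singleton, mul_comm (_ / _ : ℝ), ENNReal.ofReal_mul (by positivity),
      ENNReal.ofReal_natCast]
  simp only [h2]
  rw [← ENNReal.ofReal_tsum_of_nonneg (fun n => by positivity) h.summable, h.tsum_eq]
  simp

theorem integral_pow_poissonMeasure (r : ℝ≥0) (z : ℂ) :
    ∫ n, z ^ n ∂(poissonMeasure r) = Complex.exp (r * (z - 1)) := by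
  rw [integral_poissonMeasure]
  have h : ∀ n : ℕ, (Real.exp (-r) * r ^ n / n.factorial) • z ^ n =
      Complex.exp (-r) * ((r * z) ^ n / n.factorial) := by
    intro n
    rw [Complex.real_smul]
    push_cast
    ring
  simp only [h]
  rw [tsum_mul_left]
  have := (NormedSpace.expSeries_div_hasSum_exp ((r : ℂ) * z)).tsum_eq
  rw [← Complex.exp_eq_exp_ℂ] at this
  rw [this, ← Complex.exp_add]
  congr 1
  ring

section Block

variable {E : Type*} [MeasurableSpace E]

/-- The point measure carried by the first `n` terms of a sequence. -/
noncomputable def initialPoints (w : ℕ × (ℕ → E)) : Measure E :=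
  ∑ j ∈ Finset.range w.1, Measure.dirac (w.2 j)

theorem measurable_initialPoints : Measurable (initialPoints (E := E)) := by
  refine Measure.measurable_of_measurable_coe _ fun A hA => ?_
  refine measurable_from_prod_countable_right fun n => ?_
  simp only [initialPoints, Measure.finsetSum_apply]
  exact Finset.measurable_sum _ fun j _ =>
    (Measure.measurable_coe hA).comp (Measure.measurable_dirac.comp (measurable_pi_apply j))

theorem integral_initialPoints {φ : E → ℝ} (hφ : Measurable φ) (w : ℕ × (ℕ → E)) :
    ∫ x, φ x ∂(initialPoints w) = ∑ j ∈ Finset.range w.1, φ (w.2 j) := by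
  rw [initialPoints, integral_finsetSum_measure fun j _ =>
    integrable_dirac' hφ.stronglyMeasurable (by simp)]
  simp only [integral_dirac' _ _ hφ.stronglyMeasurable]

/-- The law of a Poisson number and of independent points with common law. -/
noncomputable def blockLaw (r : ℝ≥0) (ρ : Measure E) [IsProbabilityMeasure ρ] :
    Measure (ℕ × (ℕ → E)) :=
  (poissonMeasure r).prod (Measure.infinitePi fun _ => ρ)

variable (r : ℝ≥0) (ρ : Measure E) [IsProbabilityMeasure ρ]

instance : IsProbabilityMeasure (blockLaw r ρ) := by
  unfold blockLaw; infer_instance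

/-- Wald's identity: `n` points put mean mass `n * ρ A` in `A`, and the mean of `n` is `r`. -/
theorem bind_blockLaw : (blockLaw r ρ).bind initialPoints = r • ρ := by
  ext A hA
  rw [Measure.bind_apply hA measurable_initialPoints.aemeasurable, blockLaw,
    lintegral_prod (fun w => initialPoints w A)
      ((Measure.measurable_coe hA).comp measurable_initialPoints).aemeasurable]
  have h : ∀ n : ℕ, ∫⁻ x : ℕ → E, initialPoints (n, x) A ∂(Measure.infinitePi fun _ => ρ) =
      n * ρ A := by
    intro n
    simp only [initialPoints, Measure.finsetSum_apply]
    rw [lintegral_finsetSum (f := fun j (x : ℕ → E) => Measure.dirac (x j) A) _ fun j _ =>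
      (Measure.measurable_coe hA).comp (Measure.measurable_dirac.comp (measurable_pi_apply j))]
    have h1 : ∀ j : ℕ, ∫⁻ x : ℕ → E, Measure.dirac (x j) A ∂(Measure.infinitePi fun _ => ρ) =
        ρ A := by
      intro j
      simp only [Measure.dirac_apply' _ hA]
      rw [← lintegral_indicator_one hA]
      exact (measurePreserving_eval_infinitePi (fun _ : ℕ => ρ) j).lintegral_comp
        (measurable_one.indicator hA)
    simp [h1]
  simp only [h]
  rw [lintegral_mul_const _ (by fun_prop), lintegral_natCast_poissonMeasure]
  rw [Measure.smul_apply, ENNReal.smul_def, smul_eq_mul]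

/-- Given `n` points, independence yields `z ^ n` with `z = ∫ e^{iφ} dρ`; averaging over `n` gives
the Poisson generating function `exp (r (z - 1))`. -/
theorem integral_cexp_blockLaw {φ : E → ℝ} (hφ : Measurable φ) :
    ∫ w, Complex.exp ((∫ x, φ x ∂(initialPoints w) : ℝ) * Complex.I) ∂(blockLaw r ρ) =
      Complex.exp (∫ x, (Complex.exp (φ x * Complex.I) - 1) ∂(r • ρ)) := by
  set f : E → ℂ := fun x => Complex.exp (φ x * Complex.I) with hf
  have hfm : Measurable f := by fun_prop
  have hfi : Integrable f ρ := (integrable_const (1 : ℝ)).mono' hfm.aestronglyMeasurable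
    (ae_of_all _ fun x => (Complex.norm_exp_ofReal_mul_I _).le)
  have h0 : ∀ w : ℕ × (ℕ → E), Complex.exp ((∫ x, φ x ∂(initialPoints w) : ℝ) * Complex.I) =
      ∏ j : Fin w.1, f (w.2 j) := by
    intro w
    rw [integral_initialPoints hφ, Fin.prod_univ_eq_prod_range fun j => f (w.2 j)]
    simp only [hf, ← Complex.exp_sum, ← Finset.sum_mul]
    push_cast
    rfl
  simp only [h0]
  have hm : Measurable fun w : ℕ × (ℕ → E) => ∏ j : Fin w.1, f (w.2 j) :=
    measurable_from_prod_countable_right fun n => by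
      exact Finset.measurable_prod (f := fun (j : Fin n) (y : ℕ → E) => f (y j)) Finset.univ
        fun j _ => hfm.comp (measurable_pi_apply (j : ℕ))
  rw [blockLaw, integral_prod _ ((integrable_const (1 : ℝ)).mono' hm.aestronglyMeasurable
    (ae_of_all _ fun w => by
      rw [norm_prod]
      exact Finset.prod_le_one (fun _ _ => norm_nonneg _)
        fun j _ => (Complex.norm_exp_ofReal_mul_I _).le))]
  have h1 : ∀ n : ℕ, ∫ x : ℕ → E, ∏ j : Fin n, f (x j) ∂(Measure.infinitePi fun _ => ρ) =
      (∫ x, f x ∂ρ) ^ n := by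
    intro n
    have hi : iIndepFun (fun (j : Fin n) (x : ℕ → E) => x j) (Measure.infinitePi fun _ => ρ) :=
      (iIndepFun_infinitePi (P := fun _ : ℕ => ρ) (X := fun _ x => x)
        (fun _ => measurable_id)).precomp Fin.val_injective
    rw [iIndepFun.integral_fun_prod_comp (𝕜 := ℂ) (f := fun _ => f) hi
      (fun i => (measurable_pi_apply _).aemeasurable) fun i => hfm.aestronglyMeasurable]
    have h2 : ∀ j : ℕ, ∫ x : ℕ → E, f (x j) ∂(Measure.infinitePi fun _ => ρ) = ∫ x, f x ∂ρ :=
      fun j => by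
        have := (measurePreserving_eval_infinitePi (fun _ : ℕ => ρ) j)
        rw [← this.map_eq, integral_map this.measurable.aemeasurable
          hfm.aestronglyMeasurable]
        simp [Function.eval, this.map_eq]
    simp [h2]
  simp only [h1]
  rw [integral_pow_poissonMeasure, integral_smul_nnreal_measure,
    integral_sub hfi (integrable_const _)]
  simp [NNReal.smul_def]

end Block

section Bind

variable {E : Type*} [MeasurableSpace E] {Ω : Type*} [MeasurableSpace Ω] {P : Measure Ω}
  {R : Ω → Measure E}

theorem ae_integrable_of_integrable_bind (hR : Measurable R) {φ : E → ℝ} (hφ : Measurable φ)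
    (hint : Integrable φ (P.bind R)) : ∀ᵐ ω ∂P, Integrable φ (R ω) := by
  have h1 : ∫⁻ ω, ∫⁻ x, ‖φ x‖ₑ ∂(R ω) ∂P ≠ ∞ := by
    rw [← Measure.lintegral_bind hR.aemeasurable (by fun_prop)]
    exact hint.2.ne
  have h2 : Measurable fun ω => ∫⁻ x, ‖φ x‖ₑ ∂(R ω) :=
    (Measure.measurable_lintegral hφ.enorm).comp hR
  filter_upwards [ae_lt_top h2 h1] with ω hω
  exact ⟨hφ.aestronglyMeasurable, hω⟩

/-- The integral is the difference of the integrals of the positive and negative parts, which are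
measurable in `ω`. The identity is known only where `φ` is integrable for `R ω`, hence almost
everywhere. -/
theorem aemeasurable_integral_of_integrable_bind (hR : Measurable R) {φ : E → ℝ}
    (hφ : Measurable φ) (hint : Integrable φ (P.bind R)) :
    AEMeasurable (fun ω => ∫ x, φ x ∂(R ω)) P := by
  have hm : ∀ ψ : E → ℝ, Measurable ψ →
      Measurable fun ω => (∫⁻ x, ENNReal.ofReal (ψ x) ∂(R ω)).toReal := fun ψ hψ =>
    ((Measure.measurable_lintegral hψ.ennreal_ofReal).comp hR).ennreal_toReal
  refine ((hm _ hφ).sub (hm _ hφ.neg)).aemeasurable.congr ?_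
  filter_upwards [ae_integrable_of_integrable_bind hR hφ hint] with ω hω
  exact (integral_eq_lintegral_pos_part_sub_lintegral_neg_part hω).symm

end Bind

section Superposition

variable {E : Type*} [MeasurableSpace E]

/-- The superposition of countably many finite point measures. -/
noncomputable def superposition (ω : ℕ → ℕ × (ℕ → E)) : Measure E :=
  Measure.sum fun k => initialPoints (ω k)

theorem superposition_isSum (ω : ℕ → ℕ × (ℕ → E)) :
    ∃ (ι : Type) (_ : Countable ι) (x : ι → E),
      superposition ω = Measure.sum fun i => Measure.dirac (x i) := by
  refine ⟨Σ k, Fin (ω k).1, inferInstance, fun p => (ω p.1).2 p.2, ?_⟩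
  ext A hA
  rw [superposition, Measure.sum_apply _ hA, Measure.sum_apply _ hA,
    ENNReal.tsum_sigma fun k (j : Fin (ω k).1) => Measure.dirac ((ω k).2 j) A]
  congr with k
  rw [initialPoints, Measure.finsetSum_apply, tsum_fintype,
    Fin.sum_univ_eq_sum_range fun j => Measure.dirac ((ω k).2 j) A]

theorem measurable_superposition : Measurable (superposition (E := E)) := by
  refine Measure.measurable_of_measurable_coe _ fun A hA => ?_
  simp only [superposition, Measure.sum_apply _ hA]
  exact Measurable.tsum fun k => (Measure.measurable_coe hA).comp
    (measurable_initialPoints.comp (measurable_pi_apply k))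

variable (r : ℕ → ℝ≥0) (ρ : ℕ → Measure E) [∀ k, IsProbabilityMeasure (ρ k)]

/-- The law of a sequence of independent blocks of points. -/
noncomputable def superpositionLaw : Measure (ℕ → ℕ × (ℕ → E)) :=
  Measure.infinitePi fun k => blockLaw (r k) (ρ k)

instance : IsProbabilityMeasure (superpositionLaw r ρ) := by
  unfold superpositionLaw; infer_instance

theorem bind_superpositionLaw :
    (superpositionLaw r ρ).bind superposition = Measure.sum fun k => r k • ρ k := by
  ext A hA
  rw [Measure.bind_apply hA measurable_superposition.aemeasurable, Measure.sum_apply _ hA]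
  simp only [superposition, Measure.sum_apply _ hA]
  have hm : Measurable fun w : ℕ × (ℕ → E) => initialPoints w A :=
    (Measure.measurable_coe hA).comp measurable_initialPoints
  rw [lintegral_tsum (f := fun k (ω : ℕ → ℕ × (ℕ → E)) => initialPoints (ω k) A)
    fun k => (hm.comp (measurable_pi_apply k)).aemeasurable]
  congr with k
  rw [← bind_blockLaw, Measure.bind_apply hA measurable_initialPoints.aemeasurable]
  exact (measurePreserving_eval_infinitePi (fun k => blockLaw (r k) (ρ k)) k).lintegral_comp hm

/-- Finitely many blocks factor by independence. The limit passes by dominated convergence: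
integrability against the mean measure makes the series of block integrals converge almost surely.
-/
theorem integral_cexp_superposition {φ : E → ℝ} (hφ : Measurable φ)
    (hint : Integrable φ (Measure.sum fun k => r k • ρ k)) :
    ∫ ω, Complex.exp ((∫ x, φ x ∂(superposition ω) : ℝ) * Complex.I) ∂(superpositionLaw r ρ) =
      Complex.exp (∫ x, (Complex.exp (φ x * Complex.I) - 1) ∂(Measure.sum fun k => r k • ρ k)) := by
  have hB : Measurable fun w : ℕ × (ℕ → E) => ∫ x, φ x ∂(initialPoints w) := by
    simp only [integral_initialPoints hφ]
    refine measurable_from_prod_countable_right fun n => ?_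
    exact Finset.measurable_sum (f := fun (j : ℕ) (y : ℕ → E) => φ (y j)) (Finset.range n)
      fun j _ => hφ.comp (measurable_pi_apply j)
  let u : ℕ × (ℕ → E) → ℂ := fun w => Complex.exp ((∫ x, φ x ∂(initialPoints w) : ℝ) * Complex.I)
  have hu : Measurable u := by fun_prop
  have h1 : ∀ n : ℕ, ∫ ω, ∏ k : Fin n, u (ω k) ∂(superpositionLaw r ρ) =
      Complex.exp
        (∑ k ∈ Finset.range n, ∫ x, (Complex.exp (φ x * Complex.I) - 1) ∂(r k • ρ k)) := by
    intro n
    have hi : iIndepFun (fun (k : Fin n) (ω : ℕ → ℕ × (ℕ → E)) => ω k) (superpositionLaw r ρ) :=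
      (iIndepFun_infinitePi (P := fun k => blockLaw (r k) (ρ k)) (X := fun _ x => x)
        (fun _ => measurable_id)).precomp Fin.val_injective
    rw [iIndepFun.integral_fun_prod_comp (𝕜 := ℂ) (f := fun _ => u) hi
      (fun i => (measurable_pi_apply _).aemeasurable) fun i => hu.aestronglyMeasurable,
      Complex.exp_sum, ← Fin.prod_univ_eq_prod_range fun k =>
        Complex.exp (∫ x, (Complex.exp (φ x * Complex.I) - 1) ∂(r k • ρ k))]
    congr with k
    rw [← integral_cexp_blockLaw (r k) (ρ k) hφ]
    have := measurePreserving_eval_infinitePi (fun k => blockLaw (r k) (ρ k)) (k : ℕ)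
    rw [← this.map_eq, integral_map this.measurable.aemeasurable hu.aestronglyMeasurable]
    rfl
  have hlim : Tendsto (fun n : ℕ => ∫ ω, ∏ k : Fin n, u (ω k) ∂(superpositionLaw r ρ)) atTop
      (𝓝 (∫ ω, Complex.exp ((∫ x, φ x ∂(superposition ω) : ℝ) * Complex.I)
        ∂(superpositionLaw r ρ))) := by
    refine tendsto_integral_of_dominated_convergence (fun _ => 1)
      (fun n => Measurable.aestronglyMeasurable ?_) (integrable_const _)
      (fun n => ae_of_all _ fun ω => ?_) ?_
    · exact Finset.measurable_prod (f := fun (k : Fin n) (ω : ℕ → ℕ × (ℕ → E)) => u (ω k))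
        Finset.univ fun k _ => hu.comp (measurable_pi_apply (k : ℕ))
    · rw [norm_prod]
      exact Finset.prod_le_one (fun _ _ => norm_nonneg _)
        fun j _ => (Complex.norm_exp_ofReal_mul_I _).le
    · filter_upwards [ae_integrable_of_integrable_bind measurable_superposition hφ
        (by rwa [bind_superpositionLaw])] with ω hω
      have hs := (hasSum_integral_measure hω).tendsto_sum_nat
      have : ∀ n, ∏ k : Fin n, u (ω k) = Complex.exp
          ((∑ k ∈ Finset.range n, ∫ x, φ x ∂(initialPoints (ω k)) : ℝ) * Complex.I) := by
        intro n
        rw [Fin.prod_univ_eq_prod_range fun k => u (ω k)]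
        simp only [u, ← Complex.exp_sum, ← Finset.sum_mul]
        push_cast
        rfl
      simp only [this]
      exact (Complex.continuous_exp.tendsto _).comp
        (((Complex.continuous_ofReal.tendsto _).comp hs).mul_const _)
  refine tendsto_nhds_unique hlim ?_
  simp only [h1]
  exact (Complex.continuous_exp.tendsto _).comp
    (hasSum_integral_measure (integrable_cexp_mul_I_sub_one hint)).tendsto_sum_nat

end Superposition

/-- Each finite piece is its mass times its normalization; a point of `E` is needed to normalize a
zero piece. -/
theorem exists_sum_smul_eq {E : Type*} [MeasurableSpace E] [Nonempty E] (ν : Measure E)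
    [SFinite ν] : ∃ (r : ℕ → ℝ≥0) (ρ : ℕ → Measure E), (∀ k, IsProbabilityMeasure (ρ k)) ∧
      (Measure.sum fun k => r k • ρ k) = ν := by
  let m : ℕ → FiniteMeasure E := fun k => ⟨sfiniteSeq ν k, inferInstance⟩
  refine ⟨fun k => (m k).mass, fun k => (m k).normalize, fun k => inferInstance, ?_⟩
  conv_rhs => rw [← sum_sfiniteSeq ν]
  congr with k : 1
  exact (congrArg (fun μ : FiniteMeasure E => (μ : Measure E))
    (m k).self_eq_mass_smul_normalize).symm

/-! ### A measure with the Poisson functional is a Poisson process -/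

theorem tendsto_poissonMeasure_Iic (M : ℕ) :
    Tendsto (fun r : ℝ≥0 => poissonMeasure r (Set.Iic M)) atTop (𝓝 0) := by
  have h : ∀ r : ℝ≥0, poissonMeasure r (Set.Iic M) =
      ∑ k ∈ Finset.Iic M, ENNReal.ofReal (Real.exp (-r) * r ^ k / k.factorial) := by
    intro r
    rw [← Finset.coe_Iic, ← sum_measure_singleton]
    simp only [poissonMeasure_singleton]
  simp only [h]
  rw [← Finset.sum_const_zero (s := Finset.Iic M) (ι := ℕ)]
  refine tendsto_finsetSum _ fun k _ => ?_
  rw [← ENNReal.ofReal_zero]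
  refine ENNReal.tendsto_ofReal ?_
  have := ((Real.tendsto_pow_mul_exp_neg_atTop_nhds_zero k).comp
    (NNReal.tendsto_coe_atTop.2 tendsto_id)).div_const (k.factorial : ℝ)
  simpa [Function.comp_def, mul_comm] using this

section Characterization

variable {E : Type*} [MeasurableSpace E] {Ω : Type*} [MeasurableSpace Ω] {P : Measure Ω}
  {R : Ω → Measure E} {ν : Measure E}

/-- The characteristic functional of a random measure is the one of a Poisson process. -/
def HasPoissonFunctional (R : Ω → Measure E) (ν : Measure E) (P : Measure Ω) : Prop :=
  ∀ φ : E → ℝ, Measurable φ → Integrable φ ν →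
    ∫ ω, Complex.exp ((∫ x, φ x ∂(R ω) : ℝ) * Complex.I) ∂P =
      Complex.exp (∫ x, (Complex.exp (φ x * Complex.I) - 1) ∂ν)

namespace HasPoissonFunctional

/-- The functional is tested on `t` times the indicator of `A`. -/
theorem charFun_count (h : HasPoissonFunctional R ν P) (hR : Measurable R) {A : Set E}
    (hA : MeasurableSet A) (hνA : ν A < ∞) (t : ℝ) :
    charFun (P.map fun ω => (R ω A).toReal) t =
      Complex.exp (ν.real A * (Complex.exp (t * Complex.I) - 1)) := by
  have hm : Measurable fun ω => (R ω A).toReal :=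
    ((Measure.measurable_coe hA).comp hR).ennreal_toReal
  have h1 := h (A.indicator fun _ => t) (measurable_const.indicator hA)
    ((integrable_indicator_iff hA).2 (integrableOn_const hνA.ne))
  rw [charFun_apply, integral_map hm.aemeasurable (by fun_prop)]
  have h2 : ∀ x, Complex.exp ((A.indicator (fun _ => t) x : ℝ) * Complex.I) - 1 =
      A.indicator (fun _ => Complex.exp (t * Complex.I) - 1) x := by
    intro x
    by_cases hx : x ∈ A <;> simp [hx]
  simp only [h2, integral_indicator hA, setIntegral_const] at h1
  simpa [Measure.real, mul_comm] using h1

theorem map_count [IsProbabilityMeasure P] (h : HasPoissonFunctional R ν P) (hR : Measurable R)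
    {A : Set E} (hA : MeasurableSet A) (hνA : ν A < ∞) :
    P.map (fun ω => (R ω A).toReal) =
      (poissonMeasure (ν A).toNNReal).map (fun k : ℕ => (k : ℝ)) := by
  have hm : Measurable fun ω => (R ω A).toReal :=
    ((Measure.measurable_coe hA).comp hR).ennreal_toReal
  have := Measure.isProbabilityMeasure_map (μ := P) hm.aemeasurable
  refine Measure.ext_of_charFun ?_
  ext t
  rw [charFun_map_cast_poissonMeasure, h.charFun_count hR hA hνA]
  rfl

theorem ae_lt_top (hb : P.bind R = ν) (hR : Measurable R) {A : Set E}
    (hA : MeasurableSet A) (hνA : ν A < ∞) : ∀ᵐ ω ∂P, R ω A < ∞ := by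
  refine MeasureTheory.ae_lt_top ((Measure.measurable_coe hA).comp hR) ?_
  rw [← hb, Measure.bind_apply hA hR.aemeasurable] at hνA
  exact hνA.ne

theorem hasLaw_count [IsProbabilityMeasure P] (h : HasPoissonFunctional R ν P)
    (hb : P.bind R = ν) (hR : Measurable R) {A : Set E} (hA : MeasurableSet A) (hνA : ν A < ∞) :
    HasLaw (fun ω => R ω A)
      ((poissonMeasure (ν A).toNNReal).map (fun k : ℕ => (k : ℝ≥0∞))) P := by
  have hm : Measurable fun ω => R ω A := (Measure.measurable_coe hA).comp hR
  refine ⟨hm.aemeasurable, ?_⟩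
  have h1 : (fun ω => R ω A) =ᵐ[P] fun ω => ENNReal.ofReal (R ω A).toReal := by
    filter_upwards [ae_lt_top hb hR hA hνA] with ω hω
    rw [ENNReal.ofReal_toReal hω.ne]
  have h2 := congrArg (Measure.map ENNReal.ofReal) (h.map_count hR hA hνA)
  rw [Measure.map_map (by fun_prop) hm.ennreal_toReal,
    Measure.map_map (by fun_prop) (by fun_prop)] at h2
  rw [Measure.map_congr h1]
  simpa [Function.comp_def] using h2

theorem count_eq_top [IsProbabilityMeasure P] [SigmaFinite ν] (h : HasPoissonFunctional R ν P)
    (hb : P.bind R = ν) (hR : Measurable R) {A : Set E} (hA : MeasurableSet A) (hνA : ν A = ∞) :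
    ∀ᵐ ω ∂P, R ω A = ∞ := by
  -- The count of `A` dominates those of the `B m`, which are Poisson with parameters tending to
  -- infinity; so any bound `M` on it has probability `0`.
  let B : ℕ → Set E := fun m => A ∩ spanningSets ν m
  have hB : ∀ m, MeasurableSet (B m) := fun m => hA.inter (measurableSet_spanningSets ν m)
  have hνB : ∀ m, ν (B m) < ∞ := fun m =>
    (measure_mono Set.inter_subset_right).trans_lt (measure_spanningSets_lt_top ν m)
  have hlim : Tendsto (fun m => ν (B m)) atTop (𝓝 ∞) := by
    rw [← hνA]
    have : A = ⋃ m, B m := by rw [← Set.inter_iUnion, iUnion_spanningSets, Set.inter_univ]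
    conv => enter [3, 1]; rw [this]
    exact tendsto_measure_iUnion_atTop fun a b hab =>
      Set.inter_subset_inter_right _ (monotone_spanningSets ν hab)
  have hlim' : Tendsto (fun m => (ν (B m)).toNNReal) atTop atTop := by
    rw [← ENNReal.tendsto_coe_nhds_top]
    simpa only [ENNReal.coe_toNNReal (hνB _).ne] using hlim
  have hM : ∀ M : ℕ, P {ω | R ω A ≤ M} = 0 := by
    intro M
    refine le_antisymm (ge_of_tendsto' ((tendsto_poissonMeasure_Iic M).comp hlim') fun m => ?_)
      bot_le
    calc P {ω | R ω A ≤ M} ≤ P ((fun ω => R ω (B m)) ⁻¹' Set.Iic (M : ℝ≥0∞)) :=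
          measure_mono fun ω hω => (measure_mono Set.inter_subset_left).trans hω
      _ = P.map (fun ω => R ω (B m)) (Set.Iic (M : ℝ≥0∞)) :=
          (Measure.map_apply ((Measure.measurable_coe (hB m)).comp hR) measurableSet_Iic).symm
      _ = poissonMeasure (ν (B m)).toNNReal (Set.Iic M) := by
          rw [(h.hasLaw_count hb hR (hB m) (hνB m)).map_eq,
            Measure.map_apply (by fun_prop) measurableSet_Iic]
          congr 1
          ext k
          simp
      _ ≤ _ := le_rfl
  have hall : ∀ᵐ ω ∂P, ∀ M : ℕ, ¬ R ω A ≤ M := ae_all_iff.2 fun M => by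
    rw [ae_iff]
    simpa using hM M
  filter_upwards [hall] with ω hω
  by_contra hne
  obtain ⟨M, hM'⟩ := ENNReal.exists_nat_gt hne
  exact hω M hM'.le

theorem iIndepFun_toReal_count [IsProbabilityMeasure P] (h : HasPoissonFunctional R ν P)
    (hb : P.bind R = ν) (hR : Measurable R) {m : ℕ} {A : Fin m → Set E}
    (hA : ∀ i, MeasurableSet (A i))
    (hνA : ∀ i, ν (A i) < ∞) (hdisj : Pairwise (Function.onFun Disjoint A)) :
    iIndepFun (fun (i : Fin m) ω => (R ω (A i)).toReal) P := by
  have hm : ∀ i, Measurable fun ω => (R ω (A i)).toReal := fun i =>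
    ((Measure.measurable_coe (hA i)).comp hR).ennreal_toReal
  rw [iIndepFun_iff_charFun_pi fun i => (hm i).aemeasurable]
  intro t
  have hcount : ∀ i, charFun (P.map fun ω => (R ω (A i)).toReal) (t i) = _ := fun i =>
    h.charFun_count hR (hA i) (hνA i) (t i)
  simp only [hcount]
  have hint : ∀ (κ : Measure E), (∀ i, κ (A i) < ∞) → ∀ i ∈ (Finset.univ : Finset (Fin m)),
      Integrable ((A i).indicator fun _ => t i) κ := fun κ hκ i _ =>
    (integrable_indicator_iff (hA i)).2 (integrableOn_const (hκ i).ne)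
  have hintc : ∀ i ∈ (Finset.univ : Finset (Fin m)),
      Integrable ((A i).indicator fun _ => Complex.exp (t i * Complex.I) - 1) ν := fun i _ =>
    (integrable_indicator_iff (hA i)).2 (integrableOn_const (hνA i).ne)
  have h1 := h (fun x => ∑ i, (A i).indicator (fun _ => t i) x)
    (Finset.measurable_sum _ fun i _ => measurable_const.indicator (hA i))
    (integrable_finsetSum _ (hint ν hνA))
  -- By disjointness at most one indicator is non-zero at `x`. This additivity makes the joint
  -- characteristic function factor.
  have h2 : ∀ x, Complex.exp ((∑ i, (A i).indicator (fun _ => t i) x : ℝ) * Complex.I) - 1 =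
      ∑ i, (A i).indicator (fun _ => Complex.exp (t i * Complex.I) - 1) x := by
    intro x
    by_cases hx : ∃ i, x ∈ A i
    · obtain ⟨i, hi⟩ := hx
      have hj : ∀ j, j ≠ i → x ∉ A j := fun j hj hxj =>
        Set.disjoint_left.1 (hdisj hj) hxj hi
      rw [Finset.sum_eq_single_of_mem i (Finset.mem_univ i) fun j _ hji => by simp [hj j hji],
        Finset.sum_eq_single_of_mem i (Finset.mem_univ i) fun j _ hji => by simp [hj j hji]]
      simp [hi]
    · push Not at hx
      simp [hx]
  simp only [h2] at h1
  rw [integral_finsetSum _ hintc] at h1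
  simp only [integral_indicator (hA _), setIntegral_const] at h1
  have hv : Measurable fun ω => WithLp.toLp 2 fun i => (R ω (A i)).toReal :=
    (WithLp.measurable_toLp 2 _).comp (measurable_pi_lambda _ hm)
  rw [charFun_apply, integral_map hv.aemeasurable (by fun_prop), ← Complex.exp_sum]
  simp only [Complex.real_smul] at h1
  rw [← h1]
  refine integral_congr_ae ?_
  filter_upwards [ae_all_iff.2 fun i => ae_lt_top hb hR (hA i) (hνA i)] with ω hω
  rw [integral_finsetSum _ (hint _ hω)]
  simp [integral_indicator (hA _), PiLp.inner_apply, Measure.real, mul_comm]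

theorem iIndepFun_count [IsProbabilityMeasure P] [SigmaFinite ν]
    (h : HasPoissonFunctional R ν P) (hb : P.bind R = ν) (hR : Measurable R) {m : ℕ} {A : Fin m → Set E}
    (hA : ∀ i, MeasurableSet (A i))
    (hdisj : Pairwise (Function.onFun Disjoint A)) :
    iIndepFun (fun (i : Fin m) ω => R ω (A i)) P := by
  classical
  -- Sets of infinite intensity have almost surely constant count `∞`, so they may be replaced by
  -- `∅` and the constant restored through `G`.
  let A' : Fin m → Set E := fun i => if ν (A i) < ∞ then A i else ∅
  have hsub : ∀ i, A' i ⊆ A i := fun i => by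
    simp only [A']; split_ifs <;> simp
  have hi := h.iIndepFun_toReal_count hb hR (A := A')
    (fun i => by simp only [A']; split_ifs <;> simp [hA i])
    (fun i => by simp only [A']; split_ifs with hi <;> simp [hi])
    (fun i j hij => (hdisj hij).mono (hsub i) (hsub j))
  let G : Fin m → ℝ → ℝ≥0∞ := fun i y => if ν (A i) < ∞ then ENNReal.ofReal y else ∞
  refine (hi.comp G fun i => ?_).congr fun i => ?_
  · simp only [G]; split_ifs <;> fun_prop
  · by_cases hfin : ν (A i) < ∞
    · filter_upwards [ae_lt_top hb hR (hA i) hfin] with ω hω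
      simp [G, A', hfin, ENNReal.ofReal_toReal hω.ne]
    · filter_upwards [h.count_eq_top hb hR (hA i) (not_lt_top_iff.1 hfin)] with ω hω
      simp [G, hfin, hω]

end HasPoissonFunctional

end Characterization

/-- Existence of Poisson point processes with locally finite intensity. -/
theorem exists_isPoissonPointProcess {E : Type*} [TopologicalSpace E] [LocallyCompactSpace E]
    [T2Space E] [SecondCountableTopology E] [MeasurableSpace E] [BorelSpace E] [Nonempty E]
    (ν : Measure E) [IsFiniteMeasureOnCompacts ν] :
    ∃ Q : Measure (PointMeasure E), IsProbabilityMeasure Q ∧ IsPoissonPointProcess id ν Q := by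
  classical
  obtain ⟨r, ρ, hρ, hν⟩ := exists_sum_smul_eq ν
  set P := superpositionLaw r ρ
  obtain ⟨K⟩ : Nonempty (CompactExhaustion E) := inferInstance
  have hR : Measurable (superposition (E := E)) := measurable_superposition
  have hb : P.bind superposition = ν := by rw [← hν]; exact bind_superpositionLaw r ρ
  have hfun : HasPoissonFunctional superposition ν P := fun φ hφ hint => by
    rw [← hν] at hint ⊢
    exact integral_cexp_superposition r ρ hφ hint
  -- The superposition is only almost surely locally finite; off this event of full probability the
  -- zero measure is substituted.
  let G : Set (ℕ → ℕ × (ℕ → E)) := {ω | ∀ m, superposition ω (K m) < ∞}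
  have hG : MeasurableSet G := by
    simp only [G, Set.ofPred_forall]
    exact MeasurableSet.iInter fun m => measurableSet_lt
      ((Measure.measurable_coe (K.isCompact m).measurableSet).comp hR) measurable_const
  have hGae : ∀ᵐ ω ∂P, ω ∈ G := ae_all_iff.2 fun m =>
    HasPoissonFunctional.ae_lt_top hb hR (K.isCompact m).measurableSet
      (K.isCompact m).measure_lt_top
  let ζ : (ℕ → ℕ × (ℕ → E)) → PointMeasure E := fun ω =>
    if hω : ω ∈ G then ⟨superposition ω, superposition_isSum ω, fun C hC => by
      obtain ⟨m, hm⟩ := K.exists_superset_of_isCompact hC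
      exact (measure_mono hm).trans_lt (hω m)⟩
    else ⟨0, ⟨Empty, inferInstance, Empty.elim, by simp⟩, by simp⟩
  have hζ : (fun ω => (ζ ω).toMeasure) = G.piecewise superposition fun _ => 0 := by
    ext1 ω
    by_cases hω : ω ∈ G <;> simp [ζ, hω]
  have hζm : Measurable ζ := PointMeasure.measurable_of_toMeasure (by
    rw [hζ]; exact hR.piecewise hG measurable_const)
  have hζae : ∀ᵐ ω ∂P, (ζ ω).toMeasure = superposition ω := by
    filter_upwards [hGae] with ω hω
    simpa [hω] using congrFun hζ ω
  set Q := P.map ζ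
  have hQ : IsProbabilityMeasure Q := Measure.isProbabilityMeasure_map hζm.aemeasurable
  have hTm : Measurable (PointMeasure.toMeasure : PointMeasure E → Measure E) :=
    PointMeasure.measurable_toMeasure
  have hbQ : Q.bind PointMeasure.toMeasure = ν := by
    rw [← hb]
    ext A hA
    rw [Measure.bind_apply hA hTm.aemeasurable, Measure.bind_apply hA hR.aemeasurable,
      lintegral_map (f := fun κ : PointMeasure E => κ.toMeasure A)
        ((Measure.measurable_coe hA).comp hTm) hζm]
    refine lintegral_congr_ae ?_
    filter_upwards [hζae] with ω hω
    simp [hω]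
  have hfunQ : HasPoissonFunctional PointMeasure.toMeasure ν Q := by
    intro φ hφ hint
    have hm := aemeasurable_integral_of_integrable_bind hTm hφ (P := Q) (by rwa [hbQ])
    rw [integral_map hζm.aemeasurable (AEMeasurable.aestronglyMeasurable (by fun_prop)),
      ← hfun φ hφ hint]
    refine integral_congr_ae ?_
    filter_upwards [hζae] with ω hω
    simp [hω]
  exact ⟨Q, hQ, ⟨measurable_id, fun A hA hνA => hfunQ.hasLaw_count hbQ hTm hA hνA,
    fun A hA hνA => hfunQ.count_eq_top hbQ hTm hA hνA,
    fun m A hA hd => hfunQ.iIndepFun_count hbQ hTm hA hd⟩⟩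

/-! ### Products of factors close to one -/

theorem norm_prod_sub_prod_le_sum {ι : Type*} (s : Finset ι) (u v : ι → ℂ)
    (hu : ∀ i ∈ s, ‖u i‖ ≤ 1) (hv : ∀ i ∈ s, ‖v i‖ ≤ 1) :
    ‖∏ i ∈ s, u i - ∏ i ∈ s, v i‖ ≤ ∑ i ∈ s, ‖u i - v i‖ := by
  classical
  induction s using Finset.induction_on with
  | empty => simp
  | insert i s hi ih =>
    rw [Finset.prod_insert hi, Finset.prod_insert hi, Finset.sum_insert hi]
    have h1 : u i * ∏ j ∈ s, u j - v i * ∏ j ∈ s, v j =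
        (u i - v i) * ∏ j ∈ s, u j + v i * (∏ j ∈ s, u j - ∏ j ∈ s, v j) := by ring
    have h2 : ‖∏ j ∈ s, u j‖ ≤ 1 := by
      rw [norm_prod]
      exact Finset.prod_le_one (fun _ _ => norm_nonneg _)
        fun j hj => hu j (Finset.mem_insert_of_mem hj)
    have h3 := ih (fun j hj => hu j (Finset.mem_insert_of_mem hj))
      (fun j hj => hv j (Finset.mem_insert_of_mem hj))
    rw [h1]
    refine (norm_add_le _ _).trans (add_le_add ?_ ?_)
    · rw [norm_mul]
      exact mul_le_of_le_one_right (norm_nonneg _) h2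
    · rw [norm_mul]
      exact (mul_le_of_le_one_left (norm_nonneg _) (hv i (Finset.mem_insert_self _ _))).trans h3

/-- Products of characteristic functions close to `1` are exponentials in the limit. -/
theorem tendsto_prod_one_add {a : ∀ n, Fin n → ℂ} {L : ℂ} {C : ℝ} {m : ℕ → ℝ}
    (ha : ∀ n j, ‖1 + a n j‖ ≤ 1) (hL : Tendsto (fun n => ∑ j, a n j) atTop (𝓝 L))
    (hC : ∀ᶠ n in atTop, ∑ j, ‖a n j‖ ≤ C) (hm : Tendsto m atTop (𝓝 0))
    (hmax : ∀ᶠ n in atTop, ∀ j, ‖a n j‖ ≤ m n) :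
    Tendsto (fun n => ∏ j, (1 + a n j)) atTop (𝓝 (Complex.exp L)) := by
  have hexp : Tendsto (fun n => ∏ j, Complex.exp (a n j)) atTop (𝓝 (Complex.exp L)) := by
    simp only [← Complex.exp_sum]
    exact (Complex.continuous_exp.tendsto _).comp hL
  have hdiff : Tendsto (fun n => ∏ j, (1 + a n j) - ∏ j, Complex.exp (a n j)) atTop (𝓝 0) := by
    have hmC : Tendsto (fun n => |m n| * C) atTop (𝓝 0) := by simpa using hm.abs.mul_const C
    refine squeeze_zero_norm' ?_ hmC
    filter_upwards [hC, hmax, hm.eventually_le_const zero_lt_one] with n h1 h2 h3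
    -- `‖1 + a n j‖ ≤ 1` forces the real part of `a n j` to be non-positive.
    have hre : ∀ j, ‖Complex.exp (a n j)‖ ≤ 1 := by
      intro j
      rw [Complex.norm_exp, Real.exp_le_one_iff]
      have := (Complex.abs_re_le_norm _).trans (ha n j)
      simp only [Complex.add_re, Complex.one_re] at this
      linarith [(abs_le.1 this).2]
    refine (norm_prod_sub_prod_le_sum _ _ _ (fun j _ => ha n j) fun j _ => hre j).trans ?_
    calc ∑ j, ‖1 + a n j - Complex.exp (a n j)‖ ≤ ∑ j, |m n| * ‖a n j‖ := by
          refine Finset.sum_le_sum fun j _ => ?_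
          have := Complex.norm_exp_sub_one_sub_id_le ((h2 j).trans h3)
          rw [← norm_neg, show -(1 + a n j - Complex.exp (a n j)) = Complex.exp (a n j) - 1 - a n j
            by ring]
          refine this.trans ?_
          rw [sq]
          exact mul_le_mul_of_nonneg_right ((h2 j).trans (le_abs_self _)) (norm_nonneg _)
      _ = |m n| * ∑ j, ‖a n j‖ := by rw [Finset.mul_sum]
      _ ≤ |m n| * C := mul_le_mul_of_nonneg_left h1 (abs_nonneg _)
  simpa using hdiff.add hexp

/-! ### Vague convergence uniformly over sections -/

theorem integrable_coe_of_isFiniteMeasureOnCompacts {Y : Type*} [TopologicalSpace Y]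
    [MeasurableSpace Y] [OpensMeasurableSpace Y] (κ : Measure Y) [IsFiniteMeasureOnCompacts κ]
    (f : C_c(Y, ℝ≥0)) : Integrable (fun x => (f x : ℝ)) κ :=
  Continuous.integrable_of_hasCompactSupport (by fun_prop)
    (f.hasCompactSupport.comp_left (g := ((↑) : ℝ≥0 → ℝ)) rfl)

theorem abs_integral_sub_le {Y : Type*} [TopologicalSpace Y] [MeasurableSpace Y]
    [OpensMeasurableSpace Y] (κ : Measure Y) [IsFiniteMeasureOnCompacts κ]
    {f g χ : C_c(Y, ℝ≥0)} {δ : ℝ} (h : ∀ x, |(f x : ℝ) - g x| ≤ δ * χ x) :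
    |∫ x, (f x : ℝ) ∂κ - ∫ x, (g x : ℝ) ∂κ| ≤ δ * ∫ x, (χ x : ℝ) ∂κ := by
  have hi := integrable_coe_of_isFiniteMeasureOnCompacts κ
  rw [← integral_sub (hi f) (hi g), ← integral_const_mul]
  exact (abs_integral_le_integral_abs).trans
    (integral_mono ((hi f).sub (hi g)).abs ((hi χ).const_mul δ) h)

section Sections

variable {S Y : Type*} [TopologicalSpace S] [TopologicalSpace Y] [T2Space S]

/-- The section of a compactly supported function at a point of the first factor. -/
def CompactlySupportedContinuousMap.sectionAt {R : Type*} [TopologicalSpace R] [Zero R]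
    (h : C_c(S × Y, R)) (s : S) : C_c(Y, R) where
  toFun x := h (s, x)
  hasCompactSupport' := h.hasCompactSupport.comp_isClosedEmbedding
    ⟨isEmbedding_prodMkRight s, by
      have : Set.range (Prod.mk s : Y → S × Y) = Prod.fst ⁻¹' {s} := by
        ext ⟨a, b⟩; simp [eq_comm]
      rw [this]
      exact isClosed_singleton.preimage continuous_fst⟩

variable [LocallyCompactSpace Y] [T2Space Y]

/-- Compactness of the projected support makes continuity in `s` uniform in `x`; off this projection
every section vanishes. One `χ` serves all `s₀` and `δ`, so the errors can be integrated against
varying measures. -/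
theorem exists_dominating_cutoff {S : Type*} [TopologicalSpace S] (h : C_c(S × Y, ℝ≥0)) :
    ∃ χ : C_c(Y, ℝ≥0), ∀ s₀ : S, ∀ δ : ℝ, 0 < δ →
      ∀ᶠ s in 𝓝 s₀, ∀ x, |(h (s, x) : ℝ) - h (s₀, x)| ≤ δ * χ x := by
  have hK : IsCompact (Prod.snd '' tsupport h) := h.hasCompactSupport.image continuous_snd
  obtain ⟨χ, h1, -⟩ := exists_cutoff hK
  refine ⟨χ, fun s₀ δ hδ => ?_⟩
  have := hK.eventually_forall_of_forall_eventually (x₀ := s₀)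
    (P := fun s x => |(h (s, x) : ℝ) - h (s₀, x)| < δ) fun x _ => by
      have hc : Continuous fun z : S × Y => |(h (z.1, z.2) : ℝ) - h (s₀, z.2)| := by
        have h1 := h.continuous
        have h2 : Continuous fun z : S × Y => h (s₀, z.2) := h1.comp (by fun_prop)
        exact ((NNReal.continuous_coe.comp h1).sub (NNReal.continuous_coe.comp h2)).abs
      exact hc.continuousAt.eventually_lt_const (by simpa using hδ)
  filter_upwards [this] with s hs x
  by_cases hx : x ∈ Prod.snd '' tsupport h
  · rw [h1 x hx]
    simpa using (hs x hx).le
  · have h0 : ∀ t : S, h (t, x) = 0 := fun t =>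
      image_eq_zero_of_notMem_tsupport fun ht => hx ⟨_, ht, rfl⟩
    simp only [h0, sub_self, abs_zero]
    positivity

variable [MeasurableSpace Y] [OpensMeasurableSpace Y]

theorem continuous_integral_sectionAt (κ : Measure Y) [IsFiniteMeasureOnCompacts κ]
    (h : C_c(S × Y, ℝ≥0)) : Continuous fun s => ∫ x, (h (s, x) : ℝ) ∂κ := by
  obtain ⟨χ, hχ⟩ := exists_dominating_cutoff h
  refine continuous_iff_continuousAt.2 fun s₀ => Metric.tendsto_nhds.2 fun ε hε => ?_
  set C := ∫ x, (χ x : ℝ) ∂κ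
  have hC : 0 ≤ C := integral_nonneg fun x => by positivity
  filter_upwards [hχ s₀ (ε / (C + 1)) (by positivity)] with s hs
  refine (abs_integral_sub_le κ (f := h.sectionAt s) (g := h.sectionAt s₀) hs).trans_lt ?_
  change ε / (C + 1) * C < ε
  rw [div_mul_eq_mul_div, div_lt_iff₀ (by positivity)]
  nlinarith

theorem eventually_abs_lt_of_tendsto_iSup {u : ∀ n, Fin n → ℝ}
    (h : Tendsto (fun n => ⨆ j, |u n j|) atTop (𝓝 0)) {ε : ℝ} (hε : 0 < ε) :
    ∀ᶠ n in atTop, ∀ j, |u n j| < ε := by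
  filter_upwards [h.eventually_lt_const hε] with n hn j
  exact (le_ciSup (Set.finite_range _).bddAbove j).trans_lt hn

/-- Vague convergence, uniform over the rows of an array, is uniform over the sections of a
compactly supported function. -/
theorem eventually_forall_section_lt [CompactSpace S] {p : ∀ n, Fin n → Measure Y}
    [∀ n j, IsFiniteMeasureOnCompacts (p n j)] {γ : Measure Y} [IsFiniteMeasureOnCompacts γ]
    {b : ∀ n, Fin n → ℝ} (hb : ∀ n j, 0 ≤ b n j)
    (hp : ∀ f : C_c(Y, ℝ≥0), Tendsto
      (fun n => ⨆ j, |b n j * ∫ x, (f x : ℝ) ∂(p n j) - ∫ x, (f x : ℝ) ∂γ|) atTop (𝓝 0))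
    (h : C_c(S × Y, ℝ≥0)) {ε : ℝ} (hε : 0 < ε) :
    ∀ᶠ n in atTop, ∀ j, ∀ s,
      |b n j * ∫ x, (h (s, x) : ℝ) ∂(p n j) - ∫ x, (h (s, x) : ℝ) ∂γ| < ε := by
  obtain ⟨χ, hχ⟩ := exists_dominating_cutoff h
  set C := ∫ x, (χ x : ℝ) ∂γ
  have hC : 0 ≤ C := integral_nonneg fun x => by positivity
  suffices ∀ᶠ n in atTop, ∀ j, ∀ s ∈ (Set.univ : Set S),
      |b n j * ∫ x, (h (s, x) : ℝ) ∂(p n j) - ∫ x, (h (s, x) : ℝ) ∂γ| < ε by simpa using this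
  -- The estimate passes to subsets and finite unions, so it is enough to have it near each `s₀`.
  refine isCompact_univ.induction_on (p := fun T : Set S => ∀ᶠ n in atTop, ∀ j, ∀ s ∈ T,
      |b n j * ∫ x, (h (s, x) : ℝ) ∂(p n j) - ∫ x, (h (s, x) : ℝ) ∂γ| < ε) (by simp)
    (fun T T' hT hT' => ?_) (fun T T' hT hT' => ?_) fun s₀ _ => ?_
  · filter_upwards [hT'] with n hn j s hs using hn j s (hT hs)
  · filter_upwards [hT, hT'] with n hn hn' j s hs using hs.elim (hn j s) (hn' j s)
  · set δ := ε / (2 * (2 * C + 1)) with hδ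
    have hδ0 : 0 < δ := by positivity
    refine ⟨_, mem_nhdsWithin_of_mem_nhds (hχ s₀ δ hδ0), ?_⟩
    filter_upwards [eventually_abs_lt_of_tendsto_iSup (hp χ) one_pos,
      eventually_abs_lt_of_tendsto_iSup (hp (h.sectionAt s₀)) (half_pos hε)] with n h1 h2 j s hs
    have k1 := abs_integral_sub_le (p n j) (f := h.sectionAt s) (g := h.sectionAt s₀) hs
    have k2 := abs_integral_sub_le γ (f := h.sectionAt s) (g := h.sectionAt s₀) hs
    have k3 := mul_le_mul_of_nonneg_left k1 (hb n j)
    rw [← abs_of_nonneg (hb n j), ← abs_mul, abs_of_nonneg (hb n j), mul_sub] at k3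
    have k4 := (abs_lt.1 (h1 j)).2
    have k5 := h2 j
    have k6 : δ * (b n j * ∫ x, (χ x : ℝ) ∂(p n j)) ≤ δ * (C + 1) :=
      mul_le_mul_of_nonneg_left (by linarith) hδ0.le
    have k7 : δ * (2 * C + 1) = ε / 2 := by rw [hδ]; field_simp
    change |b n j * ∫ x, (h.sectionAt s x : ℝ) ∂(p n j) - ∫ x, (h.sectionAt s x : ℝ) ∂γ| < ε
    rw [abs_lt] at k5 ⊢
    rw [abs_le] at k2 k3
    constructor <;> nlinarith
end Sections

/-! ### Row sums and row products of the array -/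

theorem integral_weightMeasure (n : ℕ) {c : Fin n → ℝ} (hc : ∀ j, 0 ≤ c j) {H : I → ℝ}
    (hH : Continuous H) : ∫ s, H s ∂(weightMeasure n c : Measure I) =
      ∑ j, c j / (∑ i, c i) * H (gridPoint n j) := by
  have h1 : (weightMeasure n c : Measure I) =
      ∑ j, (c j / ∑ i, c i).toNNReal • Measure.dirac (gridPoint n j) := by
    simp only [weightMeasure, FiniteMeasure.toMeasure_sum, FiniteMeasure.toMeasure_smul]
    rfl
  have hi : ∀ j, Integrable H (Measure.dirac (gridPoint n j)) := fun j =>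
    integrable_dirac' hH.stronglyMeasurable (by simp)
  rw [h1, integral_finsetSum_measure fun j _ => (hi j).smul_measure_nnreal]
  refine Finset.sum_congr rfl fun j _ => ?_
  rw [integral_smul_nnreal_measure, integral_dirac, NNReal.smul_def,
    Real.coe_toNNReal _ (div_nonneg (hc j) (Finset.sum_nonneg fun i _ => hc i)), smul_eq_mul]

section Array

variable {Y : Type*} [TopologicalSpace Y] [LocallyCompactSpace Y] [T2Space Y]
  [MeasurableSpace Y] [BorelSpace Y]
  {p : ∀ n, Fin n → Measure Y} [∀ n j, IsFiniteMeasureOnCompacts (p n j)]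
  {γ : Measure Y} [IsFiniteMeasureOnCompacts γ] {μ : FiniteMeasure I}
  {c : ∀ n, Fin n → ℝ} {d : ℕ → ℝ}

/-- This bound of order `c n j / d n` controls both the row sum of the `‖a n j‖` and their maximum
in the product limit. -/
theorem exists_eventually_integral_section_le (hc : ∀ n j, 0 < c n j) (hd : ∀ n, d n = ∑ j, c n j)
    (hd_top : Tendsto d atTop atTop)
    (hp : ∀ f : C_c(Y, ℝ≥0), Tendsto
      (fun n => ⨆ j, |d n / c n j * ∫ x, (f x : ℝ) ∂(p n j) - ∫ x, (f x : ℝ) ∂γ|) atTop (𝓝 0))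
    (h : C_c(I × Y, ℝ≥0)) :
    ∃ C : ℝ, 0 ≤ C ∧ ∀ᶠ n in atTop, ∀ j,
      ∫ x, (h (gridPoint n j, x) : ℝ) ∂(p n j) ≤ C * (c n j / d n) := by
  have hb : ∀ n j, 0 ≤ d n / c n j := fun n j => div_nonneg
    (by rw [hd]; exact Finset.sum_nonneg fun i _ => (hc n i).le) (hc n j).le
  obtain ⟨B, hB⟩ := isCompact_univ.exists_bound_of_continuousOn
    (continuous_integral_sectionAt γ h).continuousOn
  have hB0 : 0 ≤ B := (norm_nonneg _).trans (hB 0 trivial)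
  refine ⟨B + 1, by positivity, ?_⟩
  filter_upwards [eventually_forall_section_lt hb hp h one_pos, hd_top.eventually_gt_atTop 0]
    with n hn hdn j
  have h1 := (abs_lt.1 (hn j (gridPoint n j))).2
  have h2 := (le_abs_self _).trans (hB (gridPoint n j) trivial)
  have h3 : d n / c n j * ∫ x, (h (gridPoint n j, x) : ℝ) ∂(p n j) ≤ B + 1 := by linarith
  rw [div_mul_eq_mul_div, div_le_iff₀ (hc n j)] at h3
  rw [mul_div_assoc', le_div_iff₀ hdn]
  linarith

variable [SecondCountableTopology Y]

theorem tendsto_sum_integral_section (hc : ∀ n j, 0 < c n j) (hd : ∀ n, d n = ∑ j, c n j)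
    (hd_top : Tendsto d atTop atTop)
    (hμ : Tendsto (fun n => weightMeasure n (c n)) atTop (𝓝 μ))
    (hp : ∀ f : C_c(Y, ℝ≥0), Tendsto
      (fun n => ⨆ j, |d n / c n j * ∫ x, (f x : ℝ) ∂(p n j) - ∫ x, (f x : ℝ) ∂γ|) atTop (𝓝 0))
    (h : C_c(I × Y, ℝ≥0)) :
    Tendsto (fun n => ∑ j, ∫ x, (h (gridPoint n j, x) : ℝ) ∂(p n j)) atTop
      (𝓝 (∫ z, (h z : ℝ) ∂((μ : Measure I).prod γ))) := by
  have hb : ∀ n j, 0 ≤ d n / c n j := fun n j => div_nonneg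
    (by rw [hd]; exact Finset.sum_nonneg fun i _ => (hc n i).le) (hc n j).le
  have hH := continuous_integral_sectionAt γ h
  set H : I → ℝ := fun s => ∫ x, (h (s, x) : ℝ) ∂γ with hHdef
  have h1 : Tendsto (fun n => ∑ j, c n j / d n * H (gridPoint n j)) atTop (𝓝 (∫ s, H s ∂μ)) := by
    have := FiniteMeasure.tendsto_iff_forall_integral_tendsto.1 hμ
      (BoundedContinuousFunction.mkOfCompact ⟨H, hH⟩)
    simp only [BoundedContinuousFunction.mkOfCompact_apply, ContinuousMap.coe_mk,
      integral_weightMeasure _ (fun j => (hc _ j).le) hH, ← hd] at this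
    exact this
  have h2 : ∫ z, (h z : ℝ) ∂((μ : Measure I).prod γ) = ∫ s, H s ∂μ :=
    integral_prod _ (integrable_coe_of_isFiniteMeasureOnCompacts _ h)
  rw [h2]
  -- The weights `c n j / d n` sum to `1`, so an error uniform in `j` survives averaging.
  have h3 : Tendsto (fun n => ∑ j, ∫ x, (h (gridPoint n j, x) : ℝ) ∂(p n j) -
      ∑ j, c n j / d n * H (gridPoint n j)) atTop (𝓝 0) := by
    refine Metric.tendsto_nhds.2 fun ε hε => ?_
    filter_upwards [eventually_forall_section_lt hb hp h (half_pos hε),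
      hd_top.eventually_gt_atTop 0] with n hn hdn
    have hw : ∑ j, c n j / d n = 1 := by rw [← Finset.sum_div, ← hd, div_self hdn.ne']
    rw [dist_zero_right, ← Finset.sum_sub_distrib]
    calc ‖∑ j, (∫ x, (h (gridPoint n j, x) : ℝ) ∂(p n j) - c n j / d n * H (gridPoint n j))‖
        ≤ ∑ j, c n j / d n * (ε / 2) := by
          refine norm_sum_le_of_le _ fun j _ => ?_
          have hcj := hc n j
          have : ∫ x, (h (gridPoint n j, x) : ℝ) ∂(p n j) - c n j / d n * H (gridPoint n j) =
              c n j / d n * (d n / c n j * ∫ x, (h (gridPoint n j, x) : ℝ) ∂(p n j) -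
                H (gridPoint n j)) := by
            field_simp
          rw [this, norm_mul, Real.norm_of_nonneg (by positivity)]
          gcongr
          exact (hn j _).le
      _ = ε / 2 := by rw [← Finset.sum_mul, hw, one_mul]
      _ < ε := half_lt_self hε
  simpa using h3.add h1

theorem tendsto_sum_integral_section_real (hc : ∀ n j, 0 < c n j) (hd : ∀ n, d n = ∑ j, c n j)
    (hd_top : Tendsto d atTop atTop)
    (hμ : Tendsto (fun n => weightMeasure n (c n)) atTop (𝓝 μ))
    (hp : ∀ f : C_c(Y, ℝ≥0), Tendsto
      (fun n => ⨆ j, |d n / c n j * ∫ x, (f x : ℝ) ∂(p n j) - ∫ x, (f x : ℝ) ∂γ|) atTop (𝓝 0))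
    (h : C_c(I × Y, ℝ)) :
    Tendsto (fun n => ∑ j, ∫ x, h (gridPoint n j, x) ∂(p n j)) atTop
      (𝓝 (∫ z, h z ∂((μ : Measure I).prod γ))) := by
  have h0 : ∀ z, h z = (h.nnrealPart z : ℝ) - ((-h).nnrealPart z : ℝ) := fun z =>
    (DFunLike.congr_fun h.nnrealPart_sub_nnrealPart_neg z).symm.trans (by simp)
  have h1 := (tendsto_sum_integral_section hc hd hd_top hμ hp h.nnrealPart).sub
    (tendsto_sum_integral_section hc hd hd_top hμ hp (-h).nnrealPart)
  have hi := fun (s : I) (κ : Measure Y) [IsFiniteMeasureOnCompacts κ] (f : C_c(I × Y, ℝ≥0)) =>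
    integrable_coe_of_isFiniteMeasureOnCompacts κ (f.sectionAt s)
  rw [← integral_sub (integrable_coe_of_isFiniteMeasureOnCompacts _ _)
    (integrable_coe_of_isFiniteMeasureOnCompacts _ _)] at h1
  simp only [← h0, ← Finset.sum_sub_distrib] at h1
  convert! h1 using 4 with n j
  simp only [h0]
  exact integral_sub (hi (gridPoint n j) (p n j) h.nnrealPart)
    (hi (gridPoint n j) (p n j) (-h).nnrealPart)

theorem cexp_mul_I_sub_one_eq (t : ℝ) : Complex.exp (t * Complex.I) - 1 =
    ((Real.cos t - 1 : ℝ) : ℂ) + ((Real.sin t : ℝ) : ℂ) * Complex.I := by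
  rw [Complex.exp_mul_I]
  push_cast
  ring

theorem tendsto_sum_integral_cexp_section (hc : ∀ n j, 0 < c n j) (hd : ∀ n, d n = ∑ j, c n j)
    (hd_top : Tendsto d atTop atTop)
    (hμ : Tendsto (fun n => weightMeasure n (c n)) atTop (𝓝 μ))
    (hp : ∀ f : C_c(Y, ℝ≥0), Tendsto
      (fun n => ⨆ j, |d n / c n j * ∫ x, (f x : ℝ) ∂(p n j) - ∫ x, (f x : ℝ) ∂γ|) atTop (𝓝 0))
    (g : C_c(I × Y, ℝ)) :
    Tendsto (fun n => ∑ j, ∫ x, (Complex.exp (g (gridPoint n j, x) * Complex.I) - 1) ∂(p n j))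
      atTop (𝓝 (∫ z, (Complex.exp (g z * Complex.I) - 1) ∂((μ : Measure I).prod γ))) := by
  -- Real and imaginary parts of `e^{ig} - 1`; both vanish where `g` does, hence have compact
  -- support.
  let u : C_c(I × Y, ℝ) := ⟨⟨fun z => Real.cos (g z) - 1, by fun_prop⟩,
    g.hasCompactSupport.comp_left (g := fun t => Real.cos t - 1) (by simp)⟩
  let v : C_c(I × Y, ℝ) := ⟨⟨fun z => Real.sin (g z), by fun_prop⟩,
    g.hasCompactSupport.comp_left (g := Real.sin) (by simp)⟩
  have key : ∀ {α : Type _} [TopologicalSpace α] [MeasurableSpace α] [OpensMeasurableSpace α]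
      (κ : Measure α) [IsFiniteMeasureOnCompacts κ] (u v : C_c(α, ℝ)),
      ∫ x, ((u x : ℂ) + (v x : ℂ) * Complex.I) ∂κ =
        ((∫ x, u x ∂κ : ℝ) : ℂ) + ((∫ x, v x ∂κ : ℝ) : ℂ) * Complex.I := by
    intro α _ _ _ κ _ u v
    have hu : Integrable u κ := u.continuous.integrable_of_hasCompactSupport u.hasCompactSupport
    have hv : Integrable v κ := v.continuous.integrable_of_hasCompactSupport v.hasCompactSupport
    rw [integral_add hu.ofReal (hv.ofReal.mul_const _), integral_mul_const,
      integral_complex_ofReal, integral_complex_ofReal]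
  have h1 : ∀ n j, ∫ x, (Complex.exp (g (gridPoint n j, x) * Complex.I) - 1) ∂(p n j) =
      ((∫ x, u (gridPoint n j, x) ∂(p n j) : ℝ) : ℂ) +
        ((∫ x, v (gridPoint n j, x) ∂(p n j) : ℝ) : ℂ) * Complex.I := by
    intro n j
    simp only [cexp_mul_I_sub_one_eq]
    exact key (p n j) (u.sectionAt _) (v.sectionAt _)
  have h2 : ∫ z, (Complex.exp (g z * Complex.I) - 1) ∂((μ : Measure I).prod γ) =
      ((∫ z, u z ∂((μ : Measure I).prod γ) : ℝ) : ℂ) +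
        ((∫ z, v z ∂((μ : Measure I).prod γ) : ℝ) : ℂ) * Complex.I := by
    simp only [cexp_mul_I_sub_one_eq]
    exact key _ u v
  simp only [h1, h2, Finset.sum_add_distrib, ← Finset.sum_mul, ← Complex.ofReal_sum]
  have hu := tendsto_sum_integral_section_real hc hd hd_top hμ hp u
  have hv := tendsto_sum_integral_section_real hc hd hd_top hμ hp v
  exact ((Complex.continuous_ofReal.tendsto _).comp hu).add
    (((Complex.continuous_ofReal.tendsto _).comp hv).mul_const _)

theorem tendsto_prod_one_add_integral_cexp (hc : ∀ n j, 0 < c n j)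
    (hd : ∀ n, d n = ∑ j, c n j) (hd_top : Tendsto d atTop atTop)
    (hc_max : Tendsto (fun n => (⨆ j, c n j) / d n) atTop (𝓝 0))
    (hμ : Tendsto (fun n => weightMeasure n (c n)) atTop (𝓝 μ))
    (hp : ∀ f : C_c(Y, ℝ≥0), Tendsto
      (fun n => ⨆ j, |d n / c n j * ∫ x, (f x : ℝ) ∂(p n j) - ∫ x, (f x : ℝ) ∂γ|) atTop (𝓝 0))
    (g : C_c(I × Y, ℝ))
    (hg : ∀ n j, ‖1 + ∫ x, (Complex.exp (g (gridPoint n j, x) * Complex.I) - 1) ∂(p n j)‖ ≤ 1) :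
    Tendsto (fun n => ∏ j,
        (1 + ∫ x, (Complex.exp (g (gridPoint n j, x) * Complex.I) - 1) ∂(p n j))) atTop
      (𝓝 (Complex.exp (∫ z, (Complex.exp (g z * Complex.I) - 1) ∂((μ : Measure I).prod γ)))) := by
  let h : C_c(I × Y, ℝ≥0) := ⟨⟨fun z => ‖g z‖₊, by fun_prop⟩,
    g.hasCompactSupport.comp_left (g := fun t => ‖t‖₊) (by simp)⟩
  obtain ⟨C, hC0, hC⟩ := exists_eventually_integral_section_le hc hd hd_top hp h
  have hle : ∀ n j, ‖∫ x, (Complex.exp (g (gridPoint n j, x) * Complex.I) - 1) ∂(p n j)‖ ≤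
      ∫ x, (h (gridPoint n j, x) : ℝ) ∂(p n j) := fun n j =>
    norm_integral_le_of_norm_le
      (integrable_coe_of_isFiniteMeasureOnCompacts (p n j) (h.sectionAt (gridPoint n j)))
      (ae_of_all _ fun x => norm_cexp_mul_I_sub_one_le _)
  refine tendsto_prod_one_add (C := C) (m := fun n => C * ((⨆ j, c n j) / d n)) hg
    (tendsto_sum_integral_cexp_section hc hd hd_top hμ hp g) ?_ (by simpa using hc_max.const_mul C)
    ?_
  · filter_upwards [hC, hd_top.eventually_gt_atTop 0] with n hn hdn
    calc _ ≤ ∑ j, C * (c n j / d n) := Finset.sum_le_sum fun j _ => (hle n j).trans (hn j)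
      _ = C := by rw [← Finset.mul_sum, ← Finset.sum_div, ← hd, div_self hdn.ne', mul_one]
  · filter_upwards [hC, hd_top.eventually_gt_atTop 0] with n hn hdn j
    refine (hle n j).trans ((hn j).trans ?_)
    gcongr
    exact le_ciSup (Set.finite_range _).bddAbove j

end Array

/-! ### The half-line and the empirical process -/

instance : LocallyCompactSpace PosHalfLine := isOpen_Ioi.locallyCompactSpace

theorem measurableEmbedding_posHalfLine : MeasurableEmbedding (Subtype.val : PosHalfLine → ℝ≥0∞) :=
  MeasurableEmbedding.subtype_coe measurableSet_Ioi

/-- A non-empty compact set has a least element `t`, hence lies in `Set.Ici t`. -/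
theorem isFiniteMeasureOnCompacts_of_measure_Ici_lt_top {γ : Measure PosHalfLine}
    (hγ : ∀ t : PosHalfLine, γ (Set.Ici t) < ∞) : IsFiniteMeasureOnCompacts γ := by
  refine ⟨fun K hK => ?_⟩
  rcases K.eq_empty_or_nonempty with rfl | hne
  · simp
  · obtain ⟨t, -, ht⟩ := hK.exists_isLeast hne
    exact (measure_mono fun x hx => ht hx).trans_lt (hγ t)

/-- The integral of a function on `(0, ∞]` with respect to the law of a random variable. -/
theorem integral_posLaw {Ω : Type*} [MeasurableSpace Ω] {X : Ω → ℝ≥0} {P : Measure Ω}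
    (hX : Measurable X) {F : Type*} [NormedAddCommGroup F] [NormedSpace ℝ F] {f : ℝ≥0∞ → F}
    (hf : StronglyMeasurable f) (h0 : f 0 = 0) :
    ∫ x : PosHalfLine, f x ∂(posLaw X P) = ∫ ω, f (X ω) ∂P := by
  rw [posLaw, integral_subtype_comap measurableSet_Ioi,
    setIntegral_eq_integral_of_forall_compl_eq_zero fun x hx => by
      have : x = 0 := by simpa using hx
      rw [this, h0],
    integral_map (by fun_prop) hf.aestronglyMeasurable]

instance {Ω : Type*} [MeasurableSpace Ω] (X : Ω → ℝ≥0) (P : Measure Ω) [IsFiniteMeasure P] :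
    IsFiniteMeasure (posLaw X P) :=
  ⟨by
    rw [posLaw, measurableEmbedding_posHalfLine.comap_apply]
    exact measure_lt_top _ _⟩

/-- Extension by zero of a function on `(0, ∞]` to `[0, ∞]`. -/
noncomputable def extendZero {R : Type*} [Zero R] (f : PosHalfLine → R) : ℝ≥0∞ → R :=
  Function.extend Subtype.val f 0

section ExtendZero

variable {R : Type*} [Zero R] (f : PosHalfLine → R)

@[simp] theorem extendZero_coe (x : PosHalfLine) : extendZero f x = f x :=
  Subtype.val_injective.extend_apply _ _ _

@[simp] theorem extendZero_zero : extendZero f 0 = 0 :=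
  Function.extend_apply' _ _ _ (by rintro ⟨x, hx⟩; exact x.2.ne' hx)

theorem measurable_extendZero [MeasurableSpace R] {f : PosHalfLine → R} (hf : Measurable f) :
    Measurable (extendZero f) :=
  measurableEmbedding_posHalfLine.measurable_extend hf measurable_const

end ExtendZero

/-- Replaces an index set depending on the sample by all of `Fin n`, as measurability and
independence require. -/
theorem sum_pos_eq_sum_extendZero {R : Type*} [AddCommMonoid R] (n : ℕ) (x : Fin n → ℝ≥0)
    (f : Fin n → PosHalfLine → R) :
    ∑ j : {j : Fin n // 0 < x j}, f j ⟨(x j : ℝ≥0∞), ENNReal.coe_pos.2 j.2⟩ =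
      ∑ j, extendZero (f j) (x j) := by
  have h1 : ∀ j : {j : Fin n // 0 < x j},
      f j ⟨(x j : ℝ≥0∞), ENNReal.coe_pos.2 j.2⟩ = extendZero (f j) (x j) := fun j =>
    (extendZero_coe (f j) ⟨(x j : ℝ≥0∞), ENNReal.coe_pos.2 j.2⟩).symm
  simp only [h1]
  rw [← Finset.sum_subtype {j : Fin n | 0 < x j} (by simp) fun j => extendZero (f j) (x j)]
  refine Finset.sum_subset (Finset.filter_subset _ _) fun j _ hj => ?_
  have : x j = 0 := by simpa using hj
  simp [this]

theorem toMeasure_empiricalPointMeasure (n : ℕ) (x : Fin n → ℝ≥0) :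
    (empiricalPointMeasure n x).toMeasure = ∑ j : {j : Fin n // 0 < x j},
      Measure.dirac (gridPoint n j, ⟨(x j : ℝ≥0∞), ENNReal.coe_pos.2 j.2⟩) :=
  Measure.sum_fintype _

theorem integral_empiricalPointMeasure (n : ℕ) (x : Fin n → ℝ≥0) (g : C_c(I × PosHalfLine, ℝ)) :
    ∫ z, g z ∂(empiricalPointMeasure n x).toMeasure =
      ∑ j, extendZero (fun y => g (gridPoint n j, y)) (x j) := by
  have hg : StronglyMeasurable fun z => g z := g.continuous.stronglyMeasurable
  rw [← sum_pos_eq_sum_extendZero n x fun j y => g (gridPoint n j, y),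
    toMeasure_empiricalPointMeasure,
    integral_finsetSum_measure fun j _ => integrable_dirac' hg (by simp)]
  simp only [integral_dirac' _ _ hg]

theorem measurable_empiricalPointMeasure (n : ℕ) : Measurable (empiricalPointMeasure n) := by
  refine PointMeasure.measurable_of_toMeasure <|
    Measure.measurable_of_measurable_coe _ fun A hA => ?_
  have h : ∀ x : Fin n → ℝ≥0, (empiricalPointMeasure n x).toMeasure A =
      ∑ j, extendZero (fun y =>
        A.indicator (1 : I × PosHalfLine → ℝ≥0∞) (gridPoint n j, y)) (x j) := by
    intro x
    rw [← sum_pos_eq_sum_extendZero n x fun j y =>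
      A.indicator (1 : I × PosHalfLine → ℝ≥0∞) (gridPoint n j, y), toMeasure_empiricalPointMeasure,
      Measure.finsetSum_apply]
    simp only [Measure.dirac_apply' _ hA]
  simp only [h]
  refine Finset.measurable_sum _ fun j _ => (measurable_extendZero ?_).comp
    (measurable_coe_nnreal_ennreal.comp (measurable_pi_apply j))
  exact (measurable_one.indicator hA).comp measurable_prodMk_left

/-- The integrand `e^{if} - 1`, extended by `0`, loses nothing when the law is restricted to `(0,
∞]`; adding `1` then restores the full expectation. -/
theorem one_add_integral_posLaw {Ω : Type*} [MeasurableSpace Ω] {X : Ω → ℝ≥0} {P : Measure Ω}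
    [IsProbabilityMeasure P] (hX : Measurable X) {f : PosHalfLine → ℝ} (hf : Measurable f) :
    1 + ∫ x, (Complex.exp (f x * Complex.I) - 1) ∂(posLaw X P) =
      ∫ ω, Complex.exp (extendZero f (X ω) * Complex.I) ∂P := by
  have hm : Measurable (extendZero f) := measurable_extendZero hf
  have h1 := integral_posLaw (P := P) hX
    (f := fun y => Complex.exp (extendZero f y * Complex.I) - 1)
    (Measurable.stronglyMeasurable (by fun_prop)) (by simp)
  simp only [extendZero_coe] at h1
  have hi : Integrable (fun ω => Complex.exp (extendZero f (X ω) * Complex.I)) P :=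
    (integrable_const (1 : ℝ)).mono' (Measurable.aestronglyMeasurable (by fun_prop))
      (ae_of_all _ fun ω => (Complex.norm_exp_ofReal_mul_I _).le)
  rw [h1, integral_sub hi (integrable_const _)]
  simp

theorem theorem1
    -- the array: for each `n`, independent non-negative random variables with non-atomic laws
    {Ω : ℕ → Type*} [∀ n, MeasurableSpace (Ω n)]
    (P : ∀ n, Measure (Ω n)) [∀ n, IsProbabilityMeasure (P n)]
    (X : ∀ n, Fin n → Ω n → ℝ≥0)
    (hX_meas : ∀ n j, Measurable (X n j))
    (hX_indep : ∀ n, iIndepFun (X n) (P n))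
    (hX_atom : ∀ n j (a : ℝ≥0), P n {ω | X n j ω = a} = 0)
    -- the positive constants and their row sums
    (c : ∀ n, Fin n → ℝ) (hc : ∀ n j, 0 < c n j)
    (d : ℕ → ℝ) (hd : ∀ n, d n = ∑ j, c n j)
    -- first condition
    (hd_top : Tendsto d atTop atTop)
    (hc_max : Tendsto (fun n => (⨆ j, c n j) / d n) atTop (𝓝 0))
    (μ : FiniteMeasure I)
    (hμ : Tendsto (fun n => weightMeasure n (c n)) atTop (𝓝 μ))
    -- second condition
    (γ : Measure PosHalfLine) (hγ_atom : ∀ x, γ {x} = 0)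
    (hγ : ∀ t : PosHalfLine, γ (Set.Ici t) < ∞)
    (hXγ : ∀ f : C_c(PosHalfLine, ℝ≥0),
      Tendsto (fun n => ⨆ j : Fin n,
        |d n / c n j * ∫ x, (f x : ℝ) ∂(posLaw (X n j) (P n)) - ∫ x, (f x : ℝ) ∂γ|)
        atTop (𝓝 0)) :
    -- a Poisson point process with intensity `μ × γ` exists
    (∃ Q : Measure (PointMeasure (I × PosHalfLine)), IsProbabilityMeasure Q ∧
      IsPoissonPointProcess id ((μ : Measure I).prod γ) Q) ∧
    -- and the point processes converge weakly to it
    ∀ (Ω' : Type*) [MeasurableSpace Ω'] (P' : Measure Ω') [IsProbabilityMeasure P']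
      (ζ : Ω' → PointMeasure (I × PosHalfLine)),
      IsPoissonPointProcess ζ ((μ : Measure I).prod γ) P' →
      TendstoInDistribution (fun n ω => empiricalPointMeasure n (fun j => X n j ω)) atTop ζ P P' := by
  have hγc := isFiniteMeasureOnCompacts_of_measure_Ici_lt_top hγ
  have : Nonempty PosHalfLine := ⟨⟨∞, by simp⟩⟩
  refine ⟨exists_isPoissonPointProcess _, fun Ω' _ P' _ ζ hζ => ?_⟩
  refine tendstoInDistribution_of_tendsto_charFunctional
    (fun n => (measurable_empiricalPointMeasure n).comp (measurable_pi_lambda _ (hX_meas n)))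
    hζ.measurable fun g => ?_
  have hgm : ∀ n j, Measurable fun y : PosHalfLine => g (gridPoint n j, y) := fun n j =>
    g.continuous.measurable.comp measurable_prodMk_left
  have ha : ∀ n j, 1 + ∫ x, (Complex.exp (g (gridPoint n j, x) * Complex.I) - 1)
      ∂(posLaw (X n j) (P n)) = _ := fun n j => one_add_integral_posLaw (hX_meas n j) (hgm n j)
  rw [hζ.integral_cexp g]
  convert! tendsto_prod_one_add_integral_cexp hc hd hd_top hc_max hμ hXγ g fun n j => ?_ with n
  -- The exponential of the sum over points is a product of functions of the independent `X n j`, so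
  -- its expectation factors.
  · simp only [ha, integral_empiricalPointMeasure, Complex.ofReal_sum, Finset.sum_mul,
      Complex.exp_sum]
    have hm : ∀ j, Measurable (extendZero fun y => g (gridPoint n j, y)) := fun j =>
      measurable_extendZero (hgm n j)
    exact (hX_indep n).integral_fun_prod_comp (𝕜 := ℂ)
      (f := fun j (u : ℝ≥0) =>
        Complex.exp (extendZero (fun y => g (gridPoint n j, y)) u * Complex.I))
      (fun j => (hX_meas n j).aemeasurable)
      fun j => Measurable.aestronglyMeasurable (by have := hm j; fun_prop)
  -- Each factor is the expectation of a unimodular variable.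
  · rw [ha]
    simpa using norm_integral_le_of_norm_le_const (μ := P n)
      (ae_of_all _ fun ω => (Complex.norm_exp_ofReal_mul_I
        (extendZero (fun y => g (gridPoint n j, y)) (X n j ω))).le)
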